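/- Let $\mathbb{H}^3$ be three-dimensional hyperbolic space with its distance function $d$. Let $M$ be a closed connected surface (a compact connected smooth two-dimensional manifold without boundary), smoothly immersed in $\mathbb{H}^3$ by $F : M \to \mathbb{H}^3$ (in particular, $M$ may be an embedded surface). Let $d\sigma$ be the area element of the metric induced on $M$, let $A(M)=\int_M d\sigma$ be its area, let $H=\frac{1}{2}(k_1+k_2)$ be its mean curvature, where $k_1,k_2$ are the principal curvatures with respect to a local unit normal, and let $$W(M)=\int_M H^2\,d\sigma .$$ Then $A(M)$ and $W(M)$ are finite, the extrinsic diameter $\mathrm{diam}(M)=\max_{p,q\in M} d(F(p),F(q))$ exists, and $$\mathrm{diam}(M)\le \frac{7}{2\pi}\,A(M)^{1/2}\,W(M)^{1/2}.$$ -/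

import Mathlib

open scoped Manifold ContDiff
open MeasureTheory

/-- The vector space underlying Minkowski space `ℝ^{1,3}`; coordinate `0` is the time coordinate. -/
abbrev Mink : Type := Fin 4 → ℝ

/-- The coordinate plane `ℝ²` on which surfaces are modelled. -/
abbrev Plane : Type := EuclideanSpace ℝ (Fin 2)

/-- The Lorentzian inner product `-x₀y₀ + x₁y₁ + x₂y₂ + x₃y₃`. -/
def lorentz (x y : Mink) : ℝ := -(x 0 * y 0) + x 1 * y 1 + x 2 * y 2 + x 3 * y 3

/-- Hyperbolic space `ℍ³` in the hyperboloid model: the upper sheet of `⟨x, x⟩ = -1`, with the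
Riemannian metric induced by the Lorentzian inner product. -/
def hyperbolicSpace : Set Mink := {x | lorentz x x = -1 ∧ 0 < x 0}

/-- The hyperbolic distance: `cosh d(x, y) = -⟨x, y⟩`. -/
noncomputable def hypDist (x y : Mink) : ℝ := Real.arcosh (-lorentz x y)

/-- `i`-th partial derivative of a map `φ : ℝ² → ℝ^{1,3}`. -/
noncomputable def pd (φ : Plane → Mink) (i : Fin 2) (u : Plane) : Mink :=
  fderiv ℝ φ u (EuclideanSpace.single i 1)

/-- First fundamental form `g_{ij} = ⟨∂_i φ, ∂_j φ⟩` of a local parametrization `φ`. -/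
noncomputable def firstForm (φ : Plane → Mink) (u : Plane) : Matrix (Fin 2) (Fin 2) ℝ :=
  Matrix.of fun i j => lorentz (pd φ i u) (pd φ j u)

/-- The Lorentzian cross product of three vectors, characterised by
`⟨cross3 a b c, w⟩ = det (w, a, b, c)` for all `w`. -/
noncomputable def cross3 (a b c : Mink) : Mink := fun k =>
  (if k = 0 then -1 else 1) * Matrix.det (Matrix.of ![Pi.single k 1, a, b, c])

/-- Unit normal of a local parametrization `φ` with values in `ℍ³`. It is Lorentz-orthogonal to
`φ u`, hence tangent to `ℍ³` at `φ u`, and orthogonal to `∂₁ φ` and `∂₂ φ`. -/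
noncomputable def unitNormal (φ : Plane → Mink) (u : Plane) : Mink :=
  let n := cross3 (φ u) (pd φ 0 u) (pd φ 1 u)
  (Real.sqrt (lorentz n n))⁻¹ • n

/-- Second fundamental form `h_{ij} = ⟨∇_{∂_i φ} ∂_j φ, ν⟩` of a local parametrization in `ℍ³`.
The Levi-Civita connection of `ℍ³` is the tangential part of the flat connection of `ℝ^{1,3}` and
`ν` is tangent to `ℍ³`, so this is `⟨∂_i ∂_j φ, ν⟩`. -/
noncomputable def secondForm (φ : Plane → Mink) (u : Plane) : Matrix (Fin 2) (Fin 2) ℝ :=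
  Matrix.of fun i j => lorentz (pd (pd φ j) i u) (unitNormal φ u)

/-- The matrix `g⁻¹ h` of the shape operator; its eigenvalues are the principal curvatures
`k₁`, `k₂`. -/
noncomputable def shapeOperator (φ : Plane → Mink) (u : Plane) : Matrix (Fin 2) (Fin 2) ℝ :=
  (firstForm φ u)⁻¹ * secondForm φ u

section Surface

variable {M : Type*} [TopologicalSpace M] [ChartedSpace Plane M]

/-- `F` is a smooth immersion of the surface `M` into `ℍ³`. -/
structure IsHypImmersion (F : M → Mink) : Prop where
  smooth : ContMDiff (𝓡 2) 𝓘(ℝ, Mink) ∞ F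
  mem : ∀ x, F x ∈ hyperbolicSpace
  injective_mfderiv : ∀ x, Function.Injective (mfderiv (𝓡 2) 𝓘(ℝ, Mink) F x)

/-- Mean curvature `H = (k₁ + k₂) / 2` at `x`, computed in the preferred chart at `x`. The
sign depends on the unit normal, hence on the chart; `H ^ 2` does not. -/
noncomputable def meanCurvature (F : M → Mink) (x : M) : ℝ :=
  (shapeOperator (F ∘ (chartAt Plane x).symm) (chartAt Plane x x)).trace / 2

/-- The area measure of the domain of a chart `e`: the measure `√(det g) du` on `e.target`,
transported to `M`. -/
noncomputable def chartArea [MeasurableSpace M] (F : M → Mink) (e : OpenPartialHomeomorph M Plane) :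
    Measure M :=
  (((volume : Measure Plane).restrict e.target).withDensity fun u =>
    ENNReal.ofReal (Real.sqrt (firstForm (F ∘ e.symm) u).det)).map e.symm

/-- The area measure `dσ` induced on `M` by an immersion `F`: the least measure that dominates the
area measure of each chart domain. Since these agree on overlaps, it restricts to
`chartArea F e` on the domain of each chart `e`. -/
noncomputable def areaMeasure [MeasurableSpace M] (F : M → Mink) : Measure M :=
  ⨆ e ∈ atlas Plane M, chartArea F e

/-- The area `A(M)`. -/
noncomputable def surfaceArea [MeasurableSpace M] (F : M → Mink) : ℝ :=
  (areaMeasure F).real Set.univ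

/-- The Willmore energy `W(M) = ∫_M H² dσ`. -/
noncomputable def willmoreEnergy [MeasurableSpace M] (F : M → Mink) : ℝ :=
  ∫ x, meanCurvature F x ^ 2 ∂(areaMeasure F)

end Surface

/-- The extrinsic distances between pairs of points of the surface. -/
def extrinsicDistances {M : Type*} (F : M → Mink) : Set ℝ :=
  Set.range fun p : M × M => hypDist (F p.1) (F p.2)

/-- The extrinsic diameter `max_{p, q} d(p, q)`. -/
noncomputable def extrinsicDiam {M : Type*} (F : M → Mink) : ℝ := sSup (extrinsicDistances F)

/-! ### Lorentzian linear algebra -/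

/-! The proof is a monotonicity argument in the style of Simon, run with linear functions on
Minkowski space. Fix a point `x₀` of the surface, put `q = -F x₀` and let r be the distance to `F
x₀`. Then f = ⟨q, F⟩ = cosh r. On the surface Δf = 2f + 2H⟨q, ν⟩ (`HypPatch.div_flux`) and |∇f|² =
sinh² r - ⟨q, ν⟩² (`HypPatch.gradPair_self`). On a closed surface the divergence of k(f)∇f
integrates to zero. A partition of unity reduces this to integration by parts in the plane
(`IsHypImmersion.integral_nonpos`).

For k take the square of a cutoff supported in r ≤ R, divided by sinh² r + c. Completing a square
absorbs the unknown ⟨q, ν⟩ at the cost of H²/4 (`radialWeight_bound`), and the gradient of the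
cutoff costs at most 3/R² (`mul_cutoff_le`). This bounds the integral of c · cutoff² / (sinh² r +
c)² by 3/R² times the area, plus a quarter of the Willmore energy, of the ball of radius R. Put c =
ε² and let ε tend to 0. Blowing up at `x₀` and using Fatou's lemma, the left side is at least ∫ (1 +
|v|²)⁻² dv = π over the plane. So every R-ball centred on the surface satisfies π ≤ 3A/R² + W/4,
with A and W taken over the ball (`IsHypImmersion.pi_le`).

By connectedness there are surface points at distances 0, 2R, 4R, ... from one end of a diameter,
and the R-balls around them are disjoint. Summing over more than D/(2R) balls, where D is the
diameter, gives πD/(2R) ≤ 3A/R² + W/4 (`IsHypImmersion.extrinsicDiam_mul_le`). The choice R = πD/W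
yields π²D² ≤ 12AW, and 12 ≤ (7/2)². -/

theorem lorentz_comm (x y : Mink) : lorentz x y = lorentz y x := by
  simp only [lorentz]; ring

theorem lorentz_add_left (x y z : Mink) : lorentz (x + y) z = lorentz x z + lorentz y z := by
  simp only [lorentz, Pi.add_apply]; ring

theorem lorentz_add_right (x y z : Mink) : lorentz x (y + z) = lorentz x y + lorentz x z := by
  simp only [lorentz, Pi.add_apply]; ring

theorem lorentz_smul_left (c : ℝ) (x y : Mink) : lorentz (c • x) y = c * lorentz x y := by
  simp only [lorentz, Pi.smul_apply, smul_eq_mul]; ring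

theorem lorentz_smul_right (c : ℝ) (x y : Mink) : lorentz x (c • y) = c * lorentz x y := by
  simp only [lorentz, Pi.smul_apply, smul_eq_mul]; ring

theorem lorentz_neg_left (x y : Mink) : lorentz (-x) y = -lorentz x y := by
  simp only [lorentz, Pi.neg_apply]; ring

theorem lorentz_sub_left (x y z : Mink) : lorentz (x - y) z = lorentz x z - lorentz y z := by
  simp only [lorentz, Pi.sub_apply]; ring

theorem lorentz_sub_right (x y z : Mink) : lorentz x (y - z) = lorentz x y - lorentz x z := by
  simp only [lorentz, Pi.sub_apply]; ring

/-- The Lorentzian inner product as a continuous bilinear map. -/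
noncomputable def lorentzCLM : Mink →L[ℝ] Mink →L[ℝ] ℝ :=
  (LinearMap.mk₂ ℝ lorentz lorentz_add_left lorentz_smul_left lorentz_add_right
    lorentz_smul_right).toContinuousBilinearMap

theorem lorentzCLM_apply (x y : Mink) : lorentzCLM x y = lorentz x y := rfl

theorem continuous_lorentz : Continuous fun z : Mink × Mink => lorentz z.1 z.2 := by
  unfold lorentz; fun_prop

theorem HasFDerivAt.lorentz {E : Type*} [NormedAddCommGroup E] [NormedSpace ℝ E]
    {a b : E → Mink} {a' b' : E →L[ℝ] Mink} {u : E}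
    (ha : HasFDerivAt a a' u) (hb : HasFDerivAt b b' u) :
    HasFDerivAt (fun u => lorentz (a u) (b u))
      ((lorentzCLM.precompR E (a u) b') + (lorentzCLM.precompL E a' (b u))) u :=
  lorentzCLM.hasFDerivAt_of_bilinear ha hb

theorem fderiv_lorentz_apply {E : Type*} [NormedAddCommGroup E] [NormedSpace ℝ E]
    {a b : E → Mink} {u : E} (ha : DifferentiableAt ℝ a u) (hb : DifferentiableAt ℝ b u) (v : E) :
    fderiv ℝ (fun u => lorentz (a u) (b u)) u v =
      lorentz (fderiv ℝ a u v) (b u) + lorentz (a u) (fderiv ℝ b u v) := by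
  rw [(ha.hasFDerivAt.lorentz hb.hasFDerivAt).fderiv]
  simp [lorentzCLM_apply, add_comm]

theorem ContDiffOn.lorentz {E : Type*} [NormedAddCommGroup E] [NormedSpace ℝ E]
    {a b : E → Mink} {U : Set E} {n : WithTop ℕ∞}
    (ha : ContDiffOn ℝ n a U) (hb : ContDiffOn ℝ n b U) :
    ContDiffOn ℝ n (fun u => lorentz (a u) (b u)) U := by
  have h : ContDiffOn ℝ n (fun u => lorentzCLM (a u) (b u)) U :=
    (lorentzCLM.contDiff.comp_contDiffOn ha).clm_apply hb
  exact h

/-- Orthogonality determines `v 0`, and `x 0 ^ 2` is 1 plus the squared spatial length of `x`, so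
Cauchy–Schwarz for the spatial parts leaves a full copy of the spatial length of `v`. This makes the
form positive definite on tangent spaces of ℍ³. -/
theorem lorentz_self_mul_sq_ge {x v : Mink} (hx : x ∈ hyperbolicSpace) (hv : lorentz x v = 0) :
    v 1 ^ 2 + v 2 ^ 2 + v 3 ^ 2 ≤ x 0 ^ 2 * lorentz v v := by
  obtain ⟨h1, -⟩ := hx
  simp only [lorentz] at *
  have h2 : x 0 * v 0 = x 1 * v 1 + x 2 * v 2 + x 3 * v 3 := by linarith
  have h3 : x 0 ^ 2 = 1 + x 1 ^ 2 + x 2 ^ 2 + x 3 ^ 2 := by nlinarith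
  have h4 : x 0 ^ 2 * (-(v 0 * v 0) + v 1 * v 1 + v 2 * v 2 + v 3 * v 3) =
      x 0 ^ 2 * (v 1 ^ 2 + v 2 ^ 2 + v 3 ^ 2) - (x 1 * v 1 + x 2 * v 2 + x 3 * v 3) ^ 2 := by
    rw [← h2]; ring
  rw [h4, h3]
  nlinarith [sq_nonneg (x 1 * v 2 - x 2 * v 1), sq_nonneg (x 1 * v 3 - x 3 * v 1),
    sq_nonneg (x 2 * v 3 - x 3 * v 2)]

theorem lorentz_self_nonneg {x v : Mink} (hx : x ∈ hyperbolicSpace) (hv : lorentz x v = 0) :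
    0 ≤ lorentz v v := by
  have h := lorentz_self_mul_sq_ge hx hv
  have h0 : 0 < x 0 ^ 2 := pow_pos hx.2 2
  by_contra hneg
  push Not at hneg
  nlinarith [mul_neg_of_pos_of_neg h0 hneg, sq_nonneg (v 1), sq_nonneg (v 2), sq_nonneg (v 3)]

theorem lorentz_self_pos {x v : Mink} (hx : x ∈ hyperbolicSpace) (hv : lorentz x v = 0)
    (hne : v ≠ 0) : 0 < lorentz v v := by
  refine lt_of_le_of_ne (lorentz_self_nonneg hx hv) fun h0 => hne ?_
  have h := lorentz_self_mul_sq_ge hx hv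
  rw [← h0, mul_zero] at h
  have h1 : v 1 = 0 := by nlinarith [sq_nonneg (v 1), sq_nonneg (v 2), sq_nonneg (v 3)]
  have h2 : v 2 = 0 := by nlinarith [sq_nonneg (v 1), sq_nonneg (v 2), sq_nonneg (v 3)]
  have h3 : v 3 = 0 := by nlinarith [sq_nonneg (v 1), sq_nonneg (v 2), sq_nonneg (v 3)]
  have h4 : v 0 = 0 := by
    simp only [lorentz, h1, h2, h3] at h0
    nlinarith
  funext i
  fin_cases i <;> simp [h1, h2, h3, h4]

/-- Reverse Cauchy–Schwarz: for spatial parts x, y in ℝ³, (1 + |x|²)(1 + |y|²) - (1 + x·y)² = |x -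
y|² + |x × y|². -/
theorem one_le_neg_lorentz {x y : Mink} (hx : x ∈ hyperbolicSpace) (hy : y ∈ hyperbolicSpace) :
    1 ≤ -lorentz x y := by
  obtain ⟨h1, h1'⟩ := hx
  obtain ⟨h2, h2'⟩ := hy
  simp only [lorentz] at *
  set q := x 1 * y 1 + x 2 * y 2 + x 3 * y 3 with hq
  have hx : x 0 ^ 2 = 1 + (x 1 ^ 2 + x 2 ^ 2 + x 3 ^ 2) := by nlinarith
  have hy : y 0 ^ 2 = 1 + (y 1 ^ 2 + y 2 ^ 2 + y 3 ^ 2) := by nlinarith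
  have hcs : (1 + q) ^ 2 ≤ (x 0 * y 0) ^ 2 := by
    rw [mul_pow, hx, hy]
    nlinarith [sq_nonneg (x 1 * y 2 - x 2 * y 1), sq_nonneg (x 1 * y 3 - x 3 * y 1),
      sq_nonneg (x 2 * y 3 - x 3 * y 2), sq_nonneg (x 1 - y 1), sq_nonneg (x 2 - y 2),
      sq_nonneg (x 3 - y 3)]
  have := abs_le_of_sq_le_sq' hcs (mul_pos h1' h2').le
  linarith [this.2]

theorem lorentz_mul_self_le {x u v : Mink} (hx : x ∈ hyperbolicSpace) (hu : lorentz x u = 0)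
    (hv : lorentz x v = 0) : lorentz u v ^ 2 ≤ lorentz u u * lorentz v v := by
  have h : ∀ t : ℝ, 0 ≤ lorentz v v * (t * t) + 2 * lorentz u v * t + lorentz u u := by
    intro t
    have : lorentz x (u + t • v) = 0 := by
      rw [lorentz_add_right, lorentz_smul_right, hu, hv]; ring
    have h2 := lorentz_self_nonneg hx this
    simp only [lorentz_add_right, lorentz_add_left, lorentz_smul_left, lorentz_smul_right,
      lorentz_comm v u] at h2
    linarith
  have := discrim_le_zero h
  simp only [discrim] at this
  nlinarith

/-! ### The hyperbolic distance -/

theorem hypDist_comm (x y : Mink) : hypDist x y = hypDist y x := by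
  rw [hypDist, hypDist, lorentz_comm]

theorem hypDist_nonneg {x y : Mink} (hx : x ∈ hyperbolicSpace) (hy : y ∈ hyperbolicSpace) :
    0 ≤ hypDist x y :=
  Real.arcosh_nonneg (one_le_neg_lorentz hx hy)

theorem cosh_hypDist {x y : Mink} (hx : x ∈ hyperbolicSpace) (hy : y ∈ hyperbolicSpace) :
    Real.cosh (hypDist x y) = -lorentz x y :=
  Real.cosh_arcosh (one_le_neg_lorentz hx hy)

theorem hypDist_self {x : Mink} (hx : x ∈ hyperbolicSpace) : hypDist x x = 0 := by
  simp [hypDist, hx.1]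

theorem hypDist_triangle {x y z : Mink} (hx : x ∈ hyperbolicSpace) (hy : y ∈ hyperbolicSpace)
    (hz : z ∈ hyperbolicSpace) : hypDist x z ≤ hypDist x y + hypDist y z := by
  have h1 := hypDist_nonneg hx hy
  have h2 := hypDist_nonneg hy hz
  have h3 := hypDist_nonneg hx hz
  have hxy := one_le_neg_lorentz hx hy
  have hyz := one_le_neg_lorentz hy hz
  rw [← abs_of_nonneg h3, ← abs_of_nonneg (add_nonneg h1 h2), ← Real.cosh_le_cosh, Real.cosh_add,
    cosh_hypDist hx hz, cosh_hypDist hx hy, cosh_hypDist hy hz]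
  have s1 : Real.sinh (hypDist x y) = √(lorentz x y ^ 2 - 1) := by
    rw [hypDist, Real.sinh_arcosh hxy, neg_sq]
  have s2 : Real.sinh (hypDist y z) = √(lorentz y z ^ 2 - 1) := by
    rw [hypDist, Real.sinh_arcosh hyz, neg_sq]
  rw [s1, s2, ← Real.sqrt_mul (by nlinarith)]
  -- These vectors are the projections of `x` and `z` to the tangent space at `y`, of lengths sinh
  -- d(x, y) and sinh d(y, z). Cauchy–Schwarz for them is the required bound on cosh d(x, z).
  have hu : lorentz y (x + lorentz x y • y) = 0 := by
    rw [lorentz_add_right, lorentz_smul_right, hy.1, lorentz_comm y x]; ring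
  have hv : lorentz y (z + lorentz y z • y) = 0 := by
    rw [lorentz_add_right, lorentz_smul_right, hy.1]; ring
  have hcs := lorentz_mul_self_le hy hu hv
  simp only [lorentz_add_right, lorentz_add_left, lorentz_smul_left, lorentz_smul_right,
    lorentz_comm y x, lorentz_comm z y, hx.1, hy.1, hz.1] at hcs
  have := Real.abs_le_sqrt (le_of_le_of_eq hcs (by ring :
    _ = (lorentz x y ^ 2 - 1) * (lorentz y z ^ 2 - 1)))
  have := neg_abs_le (lorentz x z + lorentz x y * lorentz y z +
    lorentz y z * (lorentz x y + lorentz x y * -1))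
  linarith

/-! ### Cross products and Gram determinants -/

theorem lorentz_cross3 (w a b c : Mink) :
    lorentz w (cross3 a b c) = Matrix.det (Matrix.of ![w, a, b, c]) := by
  simp [lorentz, cross3, Matrix.det_succ_row_zero, Fin.sum_univ_succ, Fin.succAbove, Pi.single_apply]
  ring

/-- The Gram determinant formula `det (w, a, b, c) det (z, a, b, c) = - det Gram`. -/
theorem lorentz_cross3_mul (w z a b c : Mink) :
    lorentz w (cross3 a b c) * lorentz z (cross3 a b c) =
      -Matrix.det (Matrix.of ![
        ![lorentz w z, lorentz w a, lorentz w b, lorentz w c],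
        ![lorentz a z, lorentz a a, lorentz a b, lorentz a c],
        ![lorentz b z, lorentz b a, lorentz b b, lorentz b c],
        ![lorentz c z, lorentz c a, lorentz c b, lorentz c c]]) := by
  have h : (Matrix.of ![
        ![lorentz w z, lorentz w a, lorentz w b, lorentz w c],
        ![lorentz a z, lorentz a a, lorentz a b, lorentz a c],
        ![lorentz b z, lorentz b a, lorentz b b, lorentz b c],
        ![lorentz c z, lorentz c a, lorentz c b, lorentz c c]] : Matrix (Fin 4) (Fin 4) ℝ) =
      Matrix.of ![w, a, b, c] * Matrix.diagonal ![-1, 1, 1, 1] *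
        (Matrix.of ![z, a, b, c]).transpose := by
    ext i j
    rw [Matrix.mul_apply, Fin.sum_univ_four]
    simp only [Matrix.mul_diagonal]
    fin_cases i <;> fin_cases j <;> simp [lorentz]
  rw [h, Matrix.det_mul, Matrix.det_mul, Matrix.det_transpose, Matrix.det_diagonal,
    lorentz_cross3, lorentz_cross3, Fin.prod_univ_four]
  simp

/-- Splits ⟨w, z⟩ into its parts along `a`, along the span of `b` and `c`, and along the normal.
Multiplying through by the Gram determinant of `b`, `c` avoids any inverse, so independence is not
needed. -/
theorem lorentz_decomposition {a b c : Mink} (ha : lorentz a a = -1) (hab : lorentz a b = 0)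
    (hac : lorentz a c = 0) (w z : Mink) :
    (lorentz b b * lorentz c c - lorentz b c ^ 2) * lorentz w z =
      -(lorentz b b * lorentz c c - lorentz b c ^ 2) * (lorentz w a * lorentz z a) +
      (lorentz c c * (lorentz w b * lorentz z b) - lorentz b c * (lorentz w b * lorentz z c)
        - lorentz b c * (lorentz w c * lorentz z b) + lorentz b b * (lorentz w c * lorentz z c)) +
      lorentz w (cross3 a b c) * lorentz z (cross3 a b c) := by
  rw [lorentz_cross3_mul, lorentz_comm b a, lorentz_comm c a, lorentz_comm c b, hab, hac, ha,
    lorentz_comm a z, lorentz_comm b z, lorentz_comm c z]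
  simp [Matrix.det_succ_row_zero, Fin.sum_univ_succ, Fin.succAbove]
  ring

theorem lorentz_left_cross3 (a b c : Mink) : lorentz a (cross3 a b c) = 0 := by
  rw [lorentz_cross3]; exact Matrix.det_zero_of_row_eq (i := 0) (j := 1) (by decide) rfl

theorem lorentz_mid_cross3 (a b c : Mink) : lorentz b (cross3 a b c) = 0 := by
  rw [lorentz_cross3]; exact Matrix.det_zero_of_row_eq (i := 0) (j := 2) (by decide) rfl

theorem lorentz_right_cross3 (a b c : Mink) : lorentz c (cross3 a b c) = 0 := by
  rw [lorentz_cross3]; exact Matrix.det_zero_of_row_eq (i := 0) (j := 3) (by decide) rfl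

theorem lorentz_eq_sum_single (x y : Mink) :
    lorentz x y = -(lorentz (Pi.single 0 1) x * lorentz (Pi.single 0 1) y) +
      lorentz (Pi.single 1 1) x * lorentz (Pi.single 1 1) y +
      lorentz (Pi.single 2 1) x * lorentz (Pi.single 2 1) y +
      lorentz (Pi.single 3 1) x * lorentz (Pi.single 3 1) y := by
  simp [lorentz]

/-- Take the Lorentzian trace of `lorentz_decomposition`: with D the Gram determinant of `b`, `c`,
the left side gives 4D, and the parts along `a` and along the span of `b`, `c` give D and 2D. The
normal part is therefore D. -/
theorem lorentz_cross3_self {a b c : Mink} (ha : lorentz a a = -1) (hab : lorentz a b = 0)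
    (hac : lorentz a c = 0) :
    lorentz (cross3 a b c) (cross3 a b c) = lorentz b b * lorentz c c - lorentz b c ^ 2 := by
  have h := fun k : Fin 4 => lorentz_decomposition ha hab hac (Pi.single k 1) (Pi.single k 1)
  have hs : ∀ k : Fin 4, lorentz (Pi.single k 1) (Pi.single k 1) = if k = 0 then -1 else 1 := by
    intro k; fin_cases k <;> simp [lorentz]
  have h0 := h 0
  have h1 := h 1
  have h2 := h 2
  have h3 := h 3
  rw [hs] at h0 h1 h2 h3
  simp only [if_true, show (1 : Fin 4) ≠ 0 by decide, show (2 : Fin 4) ≠ 0 by decide,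
    show (3 : Fin 4) ≠ 0 by decide, if_false] at h0 h1 h2 h3
  set D := lorentz b b * lorentz c c - lorentz b c ^ 2 with hD
  linear_combination h0 - h1 - h2 - h3 + lorentz_eq_sum_single (cross3 a b c) (cross3 a b c)
    - D * lorentz_eq_sum_single a a + lorentz c c * lorentz_eq_sum_single b b
    - 2 * lorentz b c * lorentz_eq_sum_single b c + lorentz b b * lorentz_eq_sum_single c c
    + D * ha

/-! ### Parametrized surfaces in hyperbolic space -/

/-- `φ` restricts to a smooth immersion of the open set `U` into `ℍ³`. -/
structure HypPatch (φ : Plane → Mink) (U : Set Plane) : Prop where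
  isOpen : IsOpen U
  contDiffOn : ContDiffOn ℝ ∞ φ U
  mem : ∀ u ∈ U, φ u ∈ hyperbolicSpace
  injective_fderiv : ∀ u ∈ U, Function.Injective (fderiv ℝ φ u)

/-- The mean curvature of a parametrized surface. -/
noncomputable def patchMeanCurvature (φ : Plane → Mink) (u : Plane) : ℝ :=
  (shapeOperator φ u).trace / 2

/-- The Riemannian pairing `g^{ij} a_i b_j` of two covectors. -/
noncomputable def gradPair (φ : Plane → Mink) (u : Plane) (a b : Fin 2 → ℝ) : ℝ :=
  (lorentz (pd φ 1 u) (pd φ 1 u) * (a 0 * b 0)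
    - lorentz (pd φ 0 u) (pd φ 1 u) * (a 0 * b 1 + a 1 * b 0)
    + lorentz (pd φ 0 u) (pd φ 0 u) * (a 1 * b 1)) / (firstForm φ u).det

/-- The differential of a real function on the coordinate plane, as a row of partial derivatives. -/
noncomputable def partials (f : Plane → ℝ) (u : Plane) (i : Fin 2) : ℝ :=
  fderiv ℝ f u (EuclideanSpace.single i 1)

theorem firstForm_det (φ : Plane → Mink) (u : Plane) :
    (firstForm φ u).det = lorentz (pd φ 0 u) (pd φ 0 u) * lorentz (pd φ 1 u) (pd φ 1 u)
      - lorentz (pd φ 0 u) (pd φ 1 u) ^ 2 := by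
  rw [Matrix.det_fin_two]
  simp only [firstForm, Matrix.of_apply]
  rw [lorentz_comm (pd φ 1 u) (pd φ 0 u)]; ring

theorem plane_eq_sum (v : Plane) :
    v = v 0 • EuclideanSpace.single 0 (1 : ℝ) + v 1 • EuclideanSpace.single 1 (1 : ℝ) := by
  ext i; fin_cases i <;> simp

/-- The inverse of g is replaced by its adjugate, which turns H into a polynomial identity usable by
`linear_combination`. -/
theorem det_mul_patchMeanCurvature {φ : Plane → Mink} {u : Plane} (hD : (firstForm φ u).det ≠ 0) :
    2 * ((firstForm φ u).det * patchMeanCurvature φ u) =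
      lorentz (pd φ 1 u) (pd φ 1 u) * secondForm φ u 0 0
      - lorentz (pd φ 0 u) (pd φ 1 u) * (secondForm φ u 1 0 + secondForm φ u 0 1)
      + lorentz (pd φ 0 u) (pd φ 0 u) * secondForm φ u 1 1 := by
  rw [patchMeanCurvature, shapeOperator, Matrix.inv_def, Matrix.adjugate_fin_two, Matrix.smul_mul,
    Matrix.trace_smul, Ring.inverse_eq_inv', smul_eq_mul]
  have : (firstForm φ u).det * ((firstForm φ u).det⁻¹ *
      (!![firstForm φ u 1 1, -firstForm φ u 0 1; -firstForm φ u 1 0, firstForm φ u 0 0] *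
        secondForm φ u).trace / 2) = (!![firstForm φ u 1 1, -firstForm φ u 0 1;
          -firstForm φ u 1 0, firstForm φ u 0 0] * secondForm φ u).trace / 2 := by
    field_simp
  rw [this]
  simp only [Matrix.trace_fin_two, Matrix.mul_apply, Fin.sum_univ_two, Matrix.of_apply,
    Matrix.cons_val', Matrix.cons_val_zero, Matrix.cons_val_one, Matrix.cons_val_fin_one,
    firstForm]
  rw [lorentz_comm (pd φ 1 u) (pd φ 0 u)]
  ring

theorem continuous_cross3 :
    Continuous fun z : Mink × Mink × Mink => cross3 z.1 z.2.1 z.2.2 := by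
  refine continuous_pi fun k => continuous_const.mul (Continuous.matrix_det ?_)
  refine continuous_pi fun i => ?_
  fin_cases i
  · exact continuous_const
  · exact continuous_fst
  · exact continuous_fst.comp continuous_snd
  · exact continuous_snd.comp continuous_snd

namespace HypPatch

variable {φ : Plane → Mink} {U : Set Plane} {u : Plane}

theorem contDiffOn_pd (h : HypPatch φ U) (i : Fin 2) : ContDiffOn ℝ ∞ (pd φ i) U :=
  (h.contDiffOn.fderiv_of_isOpen h.isOpen (m := ∞) (by simp)).clm_apply contDiffOn_const

theorem contDiffOn_pd_pd (h : HypPatch φ U) (i j : Fin 2) : ContDiffOn ℝ ∞ (pd (pd φ j) i) U :=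
  ((h.contDiffOn_pd j).fderiv_of_isOpen h.isOpen (m := ∞) (by simp)).clm_apply contDiffOn_const

theorem differentiableAt (h : HypPatch φ U) (hu : u ∈ U) : DifferentiableAt ℝ φ u :=
  (h.contDiffOn.contDiffAt (h.isOpen.mem_nhds hu)).differentiableAt (by simp)

theorem differentiableAt_pd (h : HypPatch φ U) (i : Fin 2) (hu : u ∈ U) :
    DifferentiableAt ℝ (pd φ i) u :=
  ((h.contDiffOn_pd i).contDiffAt (h.isOpen.mem_nhds hu)).differentiableAt (by simp)

theorem pd_pd_comm (h : HypPatch φ U) (hu : u ∈ U) (i j : Fin 2) :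
    pd (pd φ j) i u = pd (pd φ i) j u := by
  have hc := h.contDiffOn.contDiffAt (h.isOpen.mem_nhds hu)
  have hs : IsSymmSndFDerivAt ℝ φ u := hc.isSymmSndFDerivAt (by
    rw [minSmoothness_of_isRCLikeNormedField]; exact WithTop.coe_le_coe.2 (le_top : (2 : ℕ∞) ≤ ⊤))
  have hd : DifferentiableAt ℝ (fderiv ℝ φ) u :=
    (hc.fderiv_right (m := ∞) (by simp)).differentiableAt (by simp)
  have key : ∀ i j : Fin 2, pd (pd φ j) i u =
      fderiv ℝ (fderiv ℝ φ) u (EuclideanSpace.single i 1) (EuclideanSpace.single j 1) := by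
    intro i j
    have : pd φ j = fun u => fderiv ℝ φ u (EuclideanSpace.single j 1) := rfl
    rw [this, pd, fderiv_clm_apply hd (differentiableAt_const _)]
    simp
  rw [key, key]
  exact hs _ _

theorem lorentz_pd (h : HypPatch φ U) (hu : u ∈ U) (i : Fin 2) : lorentz (φ u) (pd φ i u) = 0 := by
  have h1 := fderiv_lorentz_apply (h.differentiableAt hu) (h.differentiableAt hu)
    (EuclideanSpace.single i 1)
  have h2 : (fun u => lorentz (φ u) (φ u)) =ᶠ[nhds u] fun _ => -1 := by
    filter_upwards [h.isOpen.mem_nhds hu] with v hv using (h.mem v hv).1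
  rw [h2.fderiv_eq, lorentz_comm _ (φ u)] at h1
  simp only [fderiv_fun_const, Pi.zero_apply, zero_apply] at h1
  simp only [pd]
  linarith

/-- Differentiate ⟨φ, ∂_j φ⟩ = 0. This component of the second derivatives along φ produces the
zeroth-order term of the Laplacian in `div_flux`. -/
theorem lorentz_pd_pd (h : HypPatch φ U) (hu : u ∈ U) (i j : Fin 2) :
    lorentz (φ u) (pd (pd φ j) i u) = -lorentz (pd φ i u) (pd φ j u) := by
  have h1 := fderiv_lorentz_apply (h.differentiableAt hu) (h.differentiableAt_pd j hu)
    (EuclideanSpace.single i 1)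
  have h2 : (fun u => lorentz (φ u) (pd φ j u)) =ᶠ[nhds u] fun _ => 0 := by
    filter_upwards [h.isOpen.mem_nhds hu] with v hv using h.lorentz_pd hv j
  rw [h2.fderiv_eq] at h1
  simp only [fderiv_fun_const, Pi.zero_apply, zero_apply] at h1
  simp only [pd] at h1 ⊢
  linarith

theorem lorentz_fderiv (h : HypPatch φ U) (hu : u ∈ U) (v : Plane) :
    lorentz (φ u) (fderiv ℝ φ u v) = 0 := by
  rw [plane_eq_sum v, map_add, map_smul, map_smul, lorentz_add_right, lorentz_smul_right,
    lorentz_smul_right]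
  have h0 := h.lorentz_pd hu 0
  have h1 := h.lorentz_pd hu 1
  simp only [pd] at h0 h1
  rw [h0, h1]; ring

theorem metric_pos (h : HypPatch φ U) (hu : u ∈ U) {v : Plane} (hv : v ≠ 0) :
    0 < lorentz (fderiv ℝ φ u v) (fderiv ℝ φ u v) :=
  lorentz_self_pos (h.mem u hu) (h.lorentz_fderiv hu v)
    fun h0 => hv (h.injective_fderiv u hu (h0.trans (map_zero _).symm))

theorem det_pos (h : HypPatch φ U) (hu : u ∈ U) : 0 < (firstForm φ u).det := by
  have h0 : 0 < lorentz (pd φ 0 u) (pd φ 0 u) := h.metric_pos hu (by simp)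
  set E := lorentz (pd φ 0 u) (pd φ 0 u) with hE
  set Fm := lorentz (pd φ 0 u) (pd φ 1 u) with hF
  -- The Gram–Schmidt vector; its squared length is E(EG - F²).
  have h1 := h.metric_pos hu (v := E • EuclideanSpace.single 1 1 - Fm • EuclideanSpace.single 0 1)
    (by
      intro h1
      have := congrArg (fun v : Plane => v 1) h1
      simp at this
      exact h0.ne' this)
  rw [map_sub, map_smul, map_smul, ← pd, ← pd] at h1
  simp only [lorentz_sub_left, lorentz_sub_right, lorentz_smul_left, lorentz_smul_right,
    lorentz_comm (pd φ 1 u) (pd φ 0 u)] at h1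
  rw [firstForm_det, ← hE, ← hF]
  rw [← hE, ← hF] at h1
  by_contra hneg
  push Not at hneg
  nlinarith [mul_nonneg h0.le (neg_nonneg.2 hneg)]

theorem unitNormal_eq (h : HypPatch φ U) (hu : u ∈ U) :
    unitNormal φ u = (√(firstForm φ u).det)⁻¹ • cross3 (φ u) (pd φ 0 u) (pd φ 1 u) := by
  simp only [unitNormal]
  rw [lorentz_cross3_self (h.mem u hu).1 (h.lorentz_pd hu 0) (h.lorentz_pd hu 1), firstForm_det]

theorem lorentz_unitNormal (h : HypPatch φ U) (hu : u ∈ U) (q : Mink) :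
    lorentz q (unitNormal φ u) =
      (√(firstForm φ u).det)⁻¹ * lorentz q (cross3 (φ u) (pd φ 0 u) (pd φ 1 u)) := by
  rw [h.unitNormal_eq hu, lorentz_smul_right]

theorem pd_unitNormal (h : HypPatch φ U) (hu : u ∈ U) (i : Fin 2) :
    lorentz (pd φ i u) (unitNormal φ u) = 0 := by
  rw [h.lorentz_unitNormal hu]
  fin_cases i
  · simp [lorentz_mid_cross3]
  · simp [lorentz_right_cross3]

/-- This is `lorentz_decomposition` with w = z = q, divided by det g. The gradient of ⟨q, φ⟩ is the
tangential part of q; the component along φ enters with a plus sign because φ is timelike. -/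
theorem gradPair_self (h : HypPatch φ U) (hu : u ∈ U) (q : Mink) :
    gradPair φ u (fun i => lorentz q (pd φ i u)) (fun i => lorentz q (pd φ i u)) =
      lorentz q q + lorentz q (φ u) ^ 2 - lorentz q (unitNormal φ u) ^ 2 := by
  have hD := h.det_pos hu
  have hdec := lorentz_decomposition (h.mem u hu).1 (h.lorentz_pd hu 0) (h.lorentz_pd hu 1) q q
  rw [← firstForm_det] at hdec
  rw [gradPair, h.lorentz_unitNormal hu, div_eq_iff hD.ne', mul_pow, inv_pow, Real.sq_sqrt hD.le]
  field_simp
  linarith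

theorem contDiffOn_det (h : HypPatch φ U) : ContDiffOn ℝ ∞ (fun u => (firstForm φ u).det) U := by
  simp only [firstForm_det]
  have := fun i j => (h.contDiffOn_pd i).lorentz (h.contDiffOn_pd j)
  exact ((this 0 0).mul (this 1 1)).sub ((this 0 1).pow 2)

theorem contDiffOn_sqrt_det (h : HypPatch φ U) :
    ContDiffOn ℝ ∞ (fun u => √(firstForm φ u).det) U :=
  h.contDiffOn_det.sqrt fun _ hu => (h.det_pos hu).ne'

theorem continuousOn_cross3 (h : HypPatch φ U) :
    ContinuousOn (fun u => cross3 (φ u) (pd φ 0 u) (pd φ 1 u)) U := by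
  have hf : ContinuousOn (fun u => (φ u, pd φ 0 u, pd φ 1 u)) U :=
    h.contDiffOn.continuousOn.prodMk
      ((h.contDiffOn_pd 0).continuousOn.prodMk (h.contDiffOn_pd 1).continuousOn)
  exact (continuous_cross3.comp_continuousOn hf :)

theorem continuousOn_unitNormal (h : HypPatch φ U) : ContinuousOn (unitNormal φ) U := by
  refine ContinuousOn.congr (f := fun u => (√(firstForm φ u).det)⁻¹ •
    cross3 (φ u) (pd φ 0 u) (pd φ 1 u)) ?_ fun u hu => h.unitNormal_eq hu
  exact (h.contDiffOn_sqrt_det.continuousOn.inv₀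
    fun u hu => (Real.sqrt_pos.2 (h.det_pos hu)).ne').smul h.continuousOn_cross3

theorem continuousOn_patchMeanCurvature (h : HypPatch φ U) :
    ContinuousOn (patchMeanCurvature φ) U := by
  have hl : ∀ {a b : Plane → Mink}, ContinuousOn a U → ContinuousOn b U →
      ContinuousOn (fun u => lorentz (a u) (b u)) U :=
    fun ha hb => continuous_lorentz.comp_continuousOn (ha.prodMk hb)
  have hp := fun i => (h.contDiffOn_pd i).continuousOn
  have hs : ∀ i j, ContinuousOn (fun u => secondForm φ u i j) U := fun i j =>
    hl (h.contDiffOn_pd_pd i j).continuousOn h.continuousOn_unitNormal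
  refine ContinuousOn.congr (f := fun u => (lorentz (pd φ 1 u) (pd φ 1 u) * secondForm φ u 0 0
      - lorentz (pd φ 0 u) (pd φ 1 u) * (secondForm φ u 1 0 + secondForm φ u 0 1)
      + lorentz (pd φ 0 u) (pd φ 0 u) * secondForm φ u 1 1) / (2 * (firstForm φ u).det)) ?_ ?_
  · refine ContinuousOn.div ?_ (continuousOn_const.mul h.contDiffOn_det.continuousOn)
      fun u hu => mul_ne_zero two_ne_zero (h.det_pos hu).ne'
    exact (((hl (hp 1) (hp 1)).mul (hs 0 0)).sub ((hl (hp 0) (hp 1)).mul ((hs 1 0).add (hs 0 1)))).add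
      ((hl (hp 0) (hp 0)).mul (hs 1 1))
  · intro u hu
    have hD := (h.det_pos hu).ne'
    have := det_mul_patchMeanCurvature hD
    rw [eq_div_iff (mul_ne_zero two_ne_zero hD), ← this]
    ring

end HypPatch

/-! ### The Laplacian of a linear function and integration by parts -/

theorem partials_mul {a b : Plane → ℝ} {u : Plane} (ha : DifferentiableAt ℝ a u)
    (hb : DifferentiableAt ℝ b u) (i : Fin 2) :
    partials (fun u => a u * b u) u i = partials a u i * b u + a u * partials b u i := by
  simp only [partials]
  rw [fderiv_fun_mul ha hb]
  simp; ring

theorem partials_sub {a b : Plane → ℝ} {u : Plane} (ha : DifferentiableAt ℝ a u)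
    (hb : DifferentiableAt ℝ b u) (i : Fin 2) :
    partials (fun u => a u - b u) u i = partials a u i - partials b u i := by
  simp only [partials]
  rw [fderiv_fun_sub ha hb]
  simp

theorem partials_lorentz {a b : Plane → Mink} {u : Plane} (ha : DifferentiableAt ℝ a u)
    (hb : DifferentiableAt ℝ b u) (i : Fin 2) :
    partials (fun u => lorentz (a u) (b u)) u i =
      lorentz (pd a i u) (b u) + lorentz (a u) (pd b i u) :=
  fderiv_lorentz_apply ha hb _

theorem partials_lorentz_const (q : Mink) {b : Plane → Mink} {u : Plane}
    (hb : DifferentiableAt ℝ b u) (i : Fin 2) :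
    partials (fun u => lorentz q (b u)) u i = lorentz q (pd b i u) := by
  rw [partials_lorentz (differentiableAt_const q) hb i]
  simp [pd, lorentz]

/-- The components `√(det g) g^{ij} ∂_j f` of the gradient density of `f = ⟨q, φ⟩`. -/
noncomputable def flux (φ : Plane → Mink) (q : Mink) (i : Fin 2) (u : Plane) : ℝ :=
  (√(firstForm φ u).det)⁻¹ *
    -- In `Fin 2`, `1 - i` is the other index.
    (lorentz (pd φ (1 - i) u) (pd φ (1 - i) u) * lorentz q (pd φ i u)
      - lorentz (pd φ 0 u) (pd φ 1 u) * lorentz q (pd φ (1 - i) u))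

namespace HypPatch

variable {φ : Plane → Mink} {U : Set Plane} {u : Plane}

theorem contDiffOn_lorentz_pd (h : HypPatch φ U) (i j : Fin 2) :
    ContDiffOn ℝ ∞ (fun u => lorentz (pd φ i u) (pd φ j u)) U :=
  (h.contDiffOn_pd i).lorentz (h.contDiffOn_pd j)

theorem contDiffOn_lorentz_const_pd (h : HypPatch φ U) (q : Mink) (i : Fin 2) :
    ContDiffOn ℝ ∞ (fun u => lorentz q (pd φ i u)) U :=
  contDiffOn_const.lorentz (h.contDiffOn_pd i)

theorem contDiffOn_inv_sqrt_det (h : HypPatch φ U) :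
    ContDiffOn ℝ ∞ (fun u => (√(firstForm φ u).det)⁻¹) U :=
  h.contDiffOn_sqrt_det.inv fun _ hu => (Real.sqrt_pos.2 (h.det_pos hu)).ne'

theorem contDiffOn_flux (h : HypPatch φ U) (q : Mink) (i : Fin 2) :
    ContDiffOn ℝ ∞ (flux φ q i) U :=
  h.contDiffOn_inv_sqrt_det.mul
    (((h.contDiffOn_lorentz_pd _ _).mul (h.contDiffOn_lorentz_const_pd q i)).sub
      ((h.contDiffOn_lorentz_pd 0 1).mul (h.contDiffOn_lorentz_const_pd q _)))

theorem differentiableAt_of_contDiffOn (h : HypPatch φ U) {f : Plane → ℝ}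
    (hf : ContDiffOn ℝ ∞ f U) (hu : u ∈ U) : DifferentiableAt ℝ f u :=
  (hf.contDiffAt (h.isOpen.mem_nhds hu)).differentiableAt (by simp)

/-- Differentiate ρ²·det g = 1 for ρ = (det g)^(-1/2) and cancel ρ. -/
theorem partials_inv_sqrt_det (h : HypPatch φ U) (hu : u ∈ U) (i : Fin 2) :
    2 * partials (fun u => (√(firstForm φ u).det)⁻¹) u i * (firstForm φ u).det +
      (√(firstForm φ u).det)⁻¹ * partials (fun u => (firstForm φ u).det) u i = 0 := by
  have hr := h.differentiableAt_of_contDiffOn h.contDiffOn_inv_sqrt_det hu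
  have hD := h.differentiableAt_of_contDiffOn h.contDiffOn_det hu
  have h1 : (fun u => (√(firstForm φ u).det)⁻¹ * (√(firstForm φ u).det)⁻¹ * (firstForm φ u).det)
      =ᶠ[nhds u] fun _ => 1 := by
    filter_upwards [h.isOpen.mem_nhds hu] with v hv
    have hp := h.det_pos hv
    rw [← mul_inv, Real.mul_self_sqrt hp.le, inv_mul_cancel₀ hp.ne']
  have h2 : partials (fun u => (√(firstForm φ u).det)⁻¹ * (√(firstForm φ u).det)⁻¹ *
      (firstForm φ u).det) u i = 0 := by
    rw [partials, h1.fderiv_eq]; simp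
  rw [partials_mul (hr.fun_mul hr) hD, partials_mul hr hr] at h2
  have hne : (√(firstForm φ u).det)⁻¹ ≠ 0 := inv_ne_zero (Real.sqrt_pos.2 (h.det_pos hu)).ne'
  refine mul_left_cancel₀ hne ?_
  linear_combination h2

/-- In a parametrization, the Laplacian of `⟨q, φ⟩` is `2 ⟨q, φ⟩ + 2 H ⟨q, ν⟩`. -/
theorem div_flux (h : HypPatch φ U) (hu : u ∈ U) (q : Mink) :
    partials (flux φ q 0) u 0 + partials (flux φ q 1) u 1 =
      √(firstForm φ u).det * (2 * lorentz q (φ u) +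
        2 * patchMeanCurvature φ u * lorentz q (unitNormal φ u)) := by
  have hr := h.differentiableAt_of_contDiffOn h.contDiffOn_inv_sqrt_det hu
  have hg := fun i j => h.differentiableAt_of_contDiffOn (h.contDiffOn_lorentz_pd i j) hu
  have hq := fun i => h.differentiableAt_of_contDiffOn (h.contDiffOn_lorentz_const_pd q i) hu
  have hp := fun i => h.differentiableAt_pd i hu
  have h0 : partials (flux φ q 0) u 0 =
      partials (fun u => (√(firstForm φ u).det)⁻¹) u 0 *
        (lorentz (pd φ 1 u) (pd φ 1 u) * lorentz q (pd φ 0 u)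
          - lorentz (pd φ 0 u) (pd φ 1 u) * lorentz q (pd φ 1 u)) +
      (√(firstForm φ u).det)⁻¹ *
        ((lorentz (pd (pd φ 1) 0 u) (pd φ 1 u) + lorentz (pd φ 1 u) (pd (pd φ 1) 0 u)) *
          lorentz q (pd φ 0 u) + lorentz (pd φ 1 u) (pd φ 1 u) * lorentz q (pd (pd φ 0) 0 u) -
        ((lorentz (pd (pd φ 0) 0 u) (pd φ 1 u) + lorentz (pd φ 0 u) (pd (pd φ 1) 0 u)) *
          lorentz q (pd φ 1 u) +
          lorentz (pd φ 0 u) (pd φ 1 u) * lorentz q (pd (pd φ 1) 0 u))) := by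
    have : flux φ q 0 = fun u => (√(firstForm φ u).det)⁻¹ *
      (lorentz (pd φ 1 u) (pd φ 1 u) * lorentz q (pd φ 0 u)
        - lorentz (pd φ 0 u) (pd φ 1 u) * lorentz q (pd φ 1 u)) := by
      funext u; simp [flux]
    rw [this, partials_mul hr (((hg 1 1).fun_mul (hq 0)).fun_sub ((hg 0 1).fun_mul (hq 1))),
      partials_sub ((hg 1 1).fun_mul (hq 0)) ((hg 0 1).fun_mul (hq 1)), partials_mul (hg 1 1) (hq 0),
      partials_mul (hg 0 1) (hq 1), partials_lorentz (hp 1) (hp 1), partials_lorentz (hp 0) (hp 1),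
      partials_lorentz_const q (hp 0), partials_lorentz_const q (hp 1)]
  have h1 : partials (flux φ q 1) u 1 =
      partials (fun u => (√(firstForm φ u).det)⁻¹) u 1 *
        (lorentz (pd φ 0 u) (pd φ 0 u) * lorentz q (pd φ 1 u)
          - lorentz (pd φ 0 u) (pd φ 1 u) * lorentz q (pd φ 0 u)) +
      (√(firstForm φ u).det)⁻¹ *
        ((lorentz (pd (pd φ 0) 1 u) (pd φ 0 u) + lorentz (pd φ 0 u) (pd (pd φ 0) 1 u)) *
          lorentz q (pd φ 1 u) + lorentz (pd φ 0 u) (pd φ 0 u) * lorentz q (pd (pd φ 1) 1 u) -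
        ((lorentz (pd (pd φ 0) 1 u) (pd φ 1 u) + lorentz (pd φ 0 u) (pd (pd φ 1) 1 u)) *
          lorentz q (pd φ 0 u) +
          lorentz (pd φ 0 u) (pd φ 1 u) * lorentz q (pd (pd φ 0) 1 u))) := by
    have : flux φ q 1 = fun u => (√(firstForm φ u).det)⁻¹ *
      (lorentz (pd φ 0 u) (pd φ 0 u) * lorentz q (pd φ 1 u)
        - lorentz (pd φ 0 u) (pd φ 1 u) * lorentz q (pd φ 0 u)) := by
      funext u; simp [flux]
    rw [this, partials_mul hr (((hg 0 0).fun_mul (hq 1)).fun_sub ((hg 0 1).fun_mul (hq 0))),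
      partials_sub ((hg 0 0).fun_mul (hq 1)) ((hg 0 1).fun_mul (hq 0)), partials_mul (hg 0 0) (hq 1),
      partials_mul (hg 0 1) (hq 0), partials_lorentz (hp 0) (hp 0), partials_lorentz (hp 0) (hp 1),
      partials_lorentz_const q (hp 0), partials_lorentz_const q (hp 1)]
  have hd : ∀ i, partials (fun u => (firstForm φ u).det) u i =
      (lorentz (pd (pd φ 0) i u) (pd φ 0 u) + lorentz (pd φ 0 u) (pd (pd φ 0) i u)) *
        lorentz (pd φ 1 u) (pd φ 1 u) + lorentz (pd φ 0 u) (pd φ 0 u) *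
        (lorentz (pd (pd φ 1) i u) (pd φ 1 u) + lorentz (pd φ 1 u) (pd (pd φ 1) i u)) -
      ((lorentz (pd (pd φ 0) i u) (pd φ 1 u) + lorentz (pd φ 0 u) (pd (pd φ 1) i u)) *
        lorentz (pd φ 0 u) (pd φ 1 u) + lorentz (pd φ 0 u) (pd φ 1 u) *
        (lorentz (pd (pd φ 0) i u) (pd φ 1 u) + lorentz (pd φ 0 u) (pd (pd φ 1) i u))) := by
    intro i
    simp only [firstForm_det, sq]
    rw [partials_sub ((hg 0 0).fun_mul (hg 1 1)) ((hg 0 1).fun_mul (hg 0 1)),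
      partials_mul (hg 0 0) (hg 1 1), partials_mul (hg 0 1) (hg 0 1),
      partials_lorentz (hp 0) (hp 0), partials_lorentz (hp 0) (hp 1),
      partials_lorentz (hp 1) (hp 1)]
  have e0 := h.partials_inv_sqrt_det hu 0
  have e1 := h.partials_inv_sqrt_det hu 1
  rw [hd] at e0 e1
  have hcomm := h.pd_pd_comm hu 1 0
  have hxx := h.lorentz_pd_pd hu 0 0
  have hxm := h.lorentz_pd_pd hu 0 1
  have hyy := h.lorentz_pd_pd hu 1 1
  have ha0 := h.lorentz_pd hu 0
  have ha1 := h.lorentz_pd hu 1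
  have hH := det_mul_patchMeanCurvature (h.det_pos hu).ne'
  have hDpos := h.det_pos hu
  simp only [secondForm, Matrix.of_apply] at hH
  rw [h.lorentz_unitNormal hu, h.lorentz_unitNormal hu, h.lorentz_unitNormal hu,
    h.lorentz_unitNormal hu, hcomm] at hH
  rw [h0, h1, h.lorentz_unitNormal hu, hcomm]
  rw [hcomm] at e1
  have hdec := fun z => lorentz_decomposition (h.mem u hu).1 ha0 ha1 q z
  have hDeq := firstForm_det φ u
  generalize pd (pd φ 1) 0 u = m at *
  generalize pd (pd φ 0) 0 u = x at *
  generalize pd (pd φ 1) 1 u = y at *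
  have ln := lorentz_left_cross3 (φ u) (pd φ 0 u) (pd φ 1 u)
  have mn := lorentz_mid_cross3 (φ u) (pd φ 0 u) (pd φ 1 u)
  have rn := lorentz_right_cross3 (φ u) (pd φ 0 u) (pd φ 1 u)
  generalize cross3 (φ u) (pd φ 0 u) (pd φ 1 u) = n at *
  generalize pd φ 0 u = a at *
  generalize pd φ 1 u = b at *
  generalize φ u = w at *
  generalize patchMeanCurvature φ u = H at *
  generalize (firstForm φ u).det = D at *
  generalize partials (fun u => (√(firstForm φ u).det)⁻¹) u 0 = r0 at *
  generalize partials (fun u => (√(firstForm φ u).det)⁻¹) u 1 = r1 at *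
  have hrD : (√D)⁻¹ * (√D)⁻¹ * D = 1 := by
    rw [← mul_inv, Real.mul_self_sqrt hDpos.le, inv_mul_cancel₀ hDpos.ne']
  have hsD : √D = (√D)⁻¹ * D := by
    have := (Real.sqrt_pos.2 hDpos).ne'
    field_simp; rw [Real.sq_sqrt hDpos.le]
  generalize (√D)⁻¹ = r at *
  rw [hsD]
  clear hsD hg hq hp hr hd h0 h1
  -- The divergence equals ⟨q, Z⟩, where Z is the vector to which `hdec` is applied in `hz`, and
  -- `c0`, `c1` collect the coefficients of the two tangent vectors. By `za` and `zb`, Z has no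
  -- tangential part; these use the derivative of (det g)^(-1/2). Its part along φ gives 2⟨q, φ⟩ and
  -- its normal part gives the mean curvature.
  set c0 := r0 * lorentz b b + 2 * r * lorentz m b - r1 * lorentz a b
    - r * (lorentz m b + lorentz a y) with hc0
  set c1 := r1 * lorentz a a + 2 * r * lorentz a m - r0 * lorentz a b
    - r * (lorentz x b + lorentz a m) with hc1
  have hz := hdec (c0 • a + c1 • b + (r * lorentz b b) • x + (-(2 * r * lorentz a b)) • m +
    (r * lorentz a a) • y)
  simp only [lorentz_add_right, lorentz_add_left, lorentz_smul_left, lorentz_smul_right] at hz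
  rw [lorentz_comm x w, lorentz_comm m w, lorentz_comm y w, lorentz_comm a w, lorentz_comm b w,
    hxx, hxm, hyy, ha0, ha1, mn, rn] at hz
  simp only [lorentz_comm b a, lorentz_comm x a, lorentz_comm m a, lorentz_comm y a,
    lorentz_comm b m, lorentz_comm b y] at hz e0 e1 ⊢
  have za : c0 * lorentz a a + c1 * lorentz a b + r * lorentz b b * lorentz a x
      + -(2 * r * lorentz a b) * lorentz a m + r * lorentz a a * lorentz a y = 0 := by
    rw [hDeq] at e0
    rw [hc0, hc1]
    linear_combination (1 / 2) * e0
  have zb : c0 * lorentz a b + c1 * lorentz b b + r * lorentz b b * lorentz x b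
      + -(2 * r * lorentz a b) * lorentz m b + r * lorentz a a * lorentz y b = 0 := by
    rw [hDeq] at e1
    rw [hc0, hc1]
    linear_combination (1 / 2) * e1
  rw [za, zb] at hz
  refine mul_left_cancel₀ hDpos.ne' ?_
  subst hDeq
  linear_combination hz - (2 * (lorentz a a * lorentz b b - lorentz a b ^ 2) * H * lorentz q n) * hrD
    - lorentz q n * hH

end HypPatch

/-! ### Compactly supported fields in the plane -/

theorem contDiff_indicator_of_eq_zero {X : Plane → ℝ} {U K : Set Plane} (hU : IsOpen U)
    (hK : IsClosed K) (hKU : K ⊆ U) (hX : ContDiffOn ℝ 1 X U) (h0 : ∀ u ∈ U, u ∉ K → X u = 0) :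
    ContDiff ℝ 1 (U.indicator X) := by
  rw [contDiff_iff_contDiffAt]
  intro u
  by_cases hu : u ∈ U
  · refine (hX.contDiffAt (hU.mem_nhds hu)).congr_of_eventuallyEq ?_
    filter_upwards [hU.mem_nhds hu] with v hv using Set.indicator_of_mem hv X
  -- A point outside `U` lies in the open set `Kᶜ`, on which the extension by zero vanishes.
  · refine (contDiffAt_const (c := (0 : ℝ))).congr_of_eventuallyEq ?_
    filter_upwards [hK.isOpen_compl.mem_nhds (fun h => hu (hKU h))] with v hv
    by_cases hvU : v ∈ U
    · rw [Set.indicator_of_mem hvU, h0 v hvU hv]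
    · exact Set.indicator_of_notMem hvU X

/-- The integral of a partial derivative of a compactly supported function vanishes. -/
theorem integral_partials_eq_zero {X : Plane → ℝ} {U K : Set Plane} (hU : IsOpen U)
    (hK : IsCompact K) (hKU : K ⊆ U) (hX : ContDiffOn ℝ 1 X U) (h0 : ∀ u ∈ U, u ∉ K → X u = 0)
    (i : Fin 2) :
    IntegrableOn (fun u => partials X u i) U ∧ ∫ u in U, partials X u i = 0 := by
  have hY := contDiff_indicator_of_eq_zero hU hK.isClosed hKU hX h0
  have hYs : HasCompactSupport (U.indicator X) := by
    refine HasCompactSupport.intro hK fun u hu => ?_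
    by_cases huU : u ∈ U
    · rw [Set.indicator_of_mem huU, h0 u huU hu]
    · exact Set.indicator_of_notMem huU X
  have hint : Integrable fun u => fderiv ℝ (U.indicator X) u (EuclideanSpace.single i 1) :=
    ((hY.continuous_fderiv (by simp)).clm_apply continuous_const).integrable_of_hasCompactSupport
      (hYs.fderiv_apply ℝ _)
  have hzero : ∫ u, fderiv ℝ (U.indicator X) u (EuclideanSpace.single i 1) = 0 := by
    -- Integration by parts against the constant function 1.
    have := integral_mul_fderiv_eq_neg_fderiv_mul_of_integrable (μ := (volume : Measure Plane))
      (f := fun _ : Plane => (1 : ℝ)) (g := U.indicator X) (v := EuclideanSpace.single i 1)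
      (by simp) (by simpa using hint)
      (by simpa using hY.continuous.integrable_of_hasCompactSupport hYs)
      (fun x _ => differentiableAt_const _) (fun x _ => (hY.differentiable (by simp)) x)
    simpa using this
  have heq : (fun u => fderiv ℝ (U.indicator X) u (EuclideanSpace.single i 1)) =
      U.indicator fun u => partials X u i := by
    funext u
    by_cases hu : u ∈ U
    · rw [Set.indicator_of_mem hu, partials]
      have : U.indicator X =ᶠ[nhds u] X := by
        filter_upwards [hU.mem_nhds hu] with v hv using Set.indicator_of_mem hv X
      rw [this.fderiv_eq]
    · rw [Set.indicator_of_notMem hu]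
      have : U.indicator X =ᶠ[nhds u] fun _ => 0 := by
        filter_upwards [hK.isClosed.isOpen_compl.mem_nhds (fun h => hu (hKU h))] with v hv
        by_cases hvU : v ∈ U
        · rw [Set.indicator_of_mem hvU, h0 v hvU hv]
        · exact Set.indicator_of_notMem hvU X
      rw [this.fderiv_eq]; simp
  rw [heq] at hint hzero
  rw [integral_indicator hU.measurableSet] at hzero
  exact ⟨(integrable_indicator_iff hU.measurableSet).1 hint, hzero⟩

namespace HypPatch

variable {φ : Plane → Mink} {U : Set Plane} {u : Plane}

theorem sum_mul_flux (h : HypPatch φ U) (hu : u ∈ U) (q : Mink) (a : Fin 2 → ℝ) :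
    a 0 * flux φ q 0 u + a 1 * flux φ q 1 u =
      √(firstForm φ u).det * gradPair φ u a (fun i => lorentz q (pd φ i u)) := by
  have hD := h.det_pos hu
  have hs : √(firstForm φ u).det * (firstForm φ u).det⁻¹ = (√(firstForm φ u).det)⁻¹ := by
    have := (Real.sqrt_pos.2 hD).ne'
    field_simp
    rw [Real.sq_sqrt hD.le]
  rw [gradPair, div_eq_mul_inv, mul_comm _ (firstForm φ u).det⁻¹, ← mul_assoc, hs]
  simp [flux]
  ring

/-- The divergence theorem for the vector field `χ k(f) ∇f`, where `f = ⟨q, φ⟩` and `χ` is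
compactly supported. -/
theorem integral_div_eq_zero (h : HypPatch φ U) {K : Set Plane} (hK : IsCompact K) (hKU : K ⊆ U)
    {χ : Plane → ℝ} (hχ : ContDiffOn ℝ 1 χ U) (h0 : ∀ u ∈ U, u ∉ K → χ u = 0) (q : Mink)
    {k : ℝ → ℝ} {T : Set ℝ} (hT : IsOpen T) (hk : ContDiffOn ℝ 1 k T)
    (hfT : ∀ u ∈ U, lorentz q (φ u) ∈ T) :
    IntegrableOn (fun u => √(firstForm φ u).det *
      (χ u * (k (lorentz q (φ u)) * (2 * lorentz q (φ u) +
          2 * patchMeanCurvature φ u * lorentz q (unitNormal φ u)) +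
        deriv k (lorentz q (φ u)) * (lorentz q q + lorentz q (φ u) ^ 2 -
          lorentz q (unitNormal φ u) ^ 2)) +
      k (lorentz q (φ u)) *
        gradPair φ u (partials χ u) (fun i => lorentz q (pd φ i u)))) U ∧
    ∫ u in U, √(firstForm φ u).det *
      (χ u * (k (lorentz q (φ u)) * (2 * lorentz q (φ u) +
          2 * patchMeanCurvature φ u * lorentz q (unitNormal φ u)) +
        deriv k (lorentz q (φ u)) * (lorentz q q + lorentz q (φ u) ^ 2 -
          lorentz q (unitNormal φ u) ^ 2)) +
      k (lorentz q (φ u)) *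
        gradPair φ u (partials χ u) (fun i => lorentz q (pd φ i u))) = 0 := by
  have hone : (1 : WithTop ℕ∞) ≤ ∞ := by exact_mod_cast (le_top : (1 : ℕ∞) ≤ ⊤)
  have hf : ContDiffOn ℝ 1 (fun u => lorentz q (φ u)) U :=
    (contDiffOn_const.lorentz h.contDiffOn).of_le hone
  have hkf : ContDiffOn ℝ 1 (fun u => k (lorentz q (φ u))) U := hk.comp hf hfT
  have hX : ∀ i, ContDiffOn ℝ 1 (fun u => χ u * k (lorentz q (φ u)) * flux φ q i u) U :=
    fun i => (hχ.mul hkf).mul ((h.contDiffOn_flux q i).of_le hone)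
  have hX0 : ∀ i, ∀ u ∈ U, u ∉ K → χ u * k (lorentz q (φ u)) * flux φ q i u = 0 :=
    fun i u hu huK => by rw [h0 u hu huK]; ring
  have hdiff : ∀ {f : Plane → ℝ}, ContDiffOn ℝ 1 f U → ∀ u ∈ U, DifferentiableAt ℝ f u :=
    fun hf u hu => (hf.contDiffAt (h.isOpen.mem_nhds hu)).differentiableAt (by simp)
  obtain ⟨i0, z0⟩ := integral_partials_eq_zero h.isOpen hK hKU (hX 0) (hX0 0) 0
  obtain ⟨i1, z1⟩ := integral_partials_eq_zero h.isOpen hK hKU (hX 1) (hX0 1) 1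
  have hsum := integral_add i0 i1
  rw [z0, z1, add_zero] at hsum
  rw [← hsum]
  suffices heq : Set.EqOn _ _ U from ⟨(i0.add i1).congr_fun heq.symm h.isOpen.measurableSet,
    setIntegral_congr_fun h.isOpen.measurableSet heq⟩
  intro u hu
  have dk : ∀ i, partials (fun u => k (lorentz q (φ u))) u i =
      deriv k (lorentz q (φ u)) * lorentz q (pd φ i u) := by
    intro i
    have hk' : HasDerivAt k (deriv k (lorentz q (φ u))) (lorentz q (φ u)) :=
      ((hk.contDiffAt (hT.mem_nhds (hfT u hu))).differentiableAt (by simp)).hasDerivAt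
    rw [← partials_lorentz_const q (h.differentiableAt hu), partials, partials]
    have := hk'.comp_hasFDerivAt u (hdiff hf u hu).hasFDerivAt
    rw [HasFDerivAt.fderiv (f := fun u => k (lorentz q (φ u))) this]
    simp
  have hp : ∀ i, partials (fun u => χ u * k (lorentz q (φ u)) * flux φ q i u) u i =
      (partials χ u i * k (lorentz q (φ u)) + χ u * (deriv k (lorentz q (φ u)) *
        lorentz q (pd φ i u))) * flux φ q i u +
      χ u * k (lorentz q (φ u)) * partials (flux φ q i) u i := by
    intro i
    rw [partials_mul (hdiff (hχ.mul hkf) u hu)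
      (h.differentiableAt_of_contDiffOn (h.contDiffOn_flux q i) hu),
      partials_mul (hdiff hχ u hu) (hdiff hkf u hu), dk i]
  simp only [Pi.add_apply, hp]
  -- The three terms of the product rule: the derivative falls on the flux, on `χ`, or on `k`.
  have e1 := h.div_flux hu q
  have e2 := h.sum_mul_flux hu q (partials χ u)
  have e3 := h.sum_mul_flux hu q (fun i => lorentz q (pd φ i u))
  rw [h.gradPair_self hu] at e3
  linear_combination -(χ u * k (lorentz q (φ u))) * e1 - k (lorentz q (φ u)) * e2 -
    χ u * deriv k (lorentz q (φ u)) * e3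

end HypPatch

/-! ### Change of coordinates -/

/-- The Jacobian matrix of a map of the coordinate plane. -/
noncomputable def jac (τ : Plane → Plane) (u : Plane) (j i : Fin 2) : ℝ :=
  fderiv ℝ τ u (EuclideanSpace.single i 1) j

/-- The Jacobian determinant of a map of the coordinate plane. -/
noncomputable def jacDet (τ : Plane → Plane) (u : Plane) : ℝ :=
  jac τ u 0 0 * jac τ u 1 1 - jac τ u 0 1 * jac τ u 1 0

theorem det_fderiv_eq_jacDet (τ : Plane → Plane) (u : Plane) :
    (fderiv ℝ τ u).det = jacDet τ u := by
  rw [ContinuousLinearMap.det, ← LinearMap.det_toMatrix (EuclideanSpace.basisFun (Fin 2) ℝ).toBasis,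
    Matrix.det_fin_two]
  simp [LinearMap.toMatrix_apply, jacDet, jac]

theorem fderiv_comp_single {E : Type*} [NormedAddCommGroup E] [NormedSpace ℝ E]
    {f : Plane → E} {τ : Plane → Plane} {u : Plane} (hτ : DifferentiableAt ℝ τ u)
    (hf : DifferentiableAt ℝ f (τ u)) (i : Fin 2) :
    fderiv ℝ (f ∘ τ) u (EuclideanSpace.single i 1) =
      jac τ u 0 i • fderiv ℝ f (τ u) (EuclideanSpace.single 0 1) +
      jac τ u 1 i • fderiv ℝ f (τ u) (EuclideanSpace.single 1 1) := by
  rw [fderiv_comp u hf hτ, ContinuousLinearMap.comp_apply,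
    plane_eq_sum (fderiv ℝ τ u (EuclideanSpace.single i 1)), map_add, map_smul, map_smul]
  rfl

/-- `φ` is near `u` the reparametrization of `φ'` by the `C²` map `τ`. -/
structure Reparam (φ φ' : Plane → Mink) (τ : Plane → Plane) (u : Plane) : Prop where
  contDiffAt : ContDiffAt ℝ 2 τ u
  eventuallyEq : φ =ᶠ[nhds u] φ' ∘ τ

theorem cross3_reparam (w a b : Mink) (p q r s : ℝ) :
    cross3 w (p • a + q • b) (r • a + s • b) = (p * s - r * q) • cross3 w a b := by
  funext k
  simp only [cross3, Pi.smul_apply, smul_eq_mul]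
  rw [mul_left_comm]
  congr 1
  simp [Matrix.det_succ_row_zero, Fin.sum_univ_succ, Fin.succAbove]
  ring

namespace Reparam

variable {φ φ' : Plane → Mink} {U U' : Set Plane} {u : Plane} {τ : Plane → Plane}

theorem apply_eq (r : Reparam φ φ' τ u) : φ u = φ' (τ u) := r.eventuallyEq.self_of_nhds

theorem differentiableAt (r : Reparam φ φ' τ u) : DifferentiableAt ℝ τ u :=
  r.contDiffAt.differentiableAt (by simp)

theorem pd_eq (r : Reparam φ φ' τ u) (h' : HypPatch φ' U') (hu' : τ u ∈ U') (i : Fin 2) :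
    pd φ i u = jac τ u 0 i • pd φ' 0 (τ u) + jac τ u 1 i • pd φ' 1 (τ u) := by
  rw [pd, r.eventuallyEq.fderiv_eq]
  exact fderiv_comp_single r.differentiableAt (h'.differentiableAt hu') i

theorem eventually (r : Reparam φ φ' τ u) : ∀ᶠ v in nhds u, Reparam φ φ' τ v := by
  filter_upwards [r.contDiffAt.eventually (by decide), r.eventuallyEq.eventually_nhds] with v h1 h2
    using ⟨h1, h2⟩

theorem differentiableAt_jac (r : Reparam φ φ' τ u) (i j : Fin 2) :
    DifferentiableAt ℝ (fun v => jac τ v j i) u := by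
  have h1 : DifferentiableAt ℝ (fderiv ℝ τ) u :=
    (r.contDiffAt.fderiv_right (m := 1) (by norm_num)).differentiableAt (by simp)
  have h2 : DifferentiableAt ℝ (fun v => fderiv ℝ τ v (EuclideanSpace.single i 1)) u :=
    h1.clm_apply (differentiableAt_const _)
  exact (EuclideanSpace.proj (𝕜 := ℝ) j).differentiableAt.comp u h2

theorem det_eq (r : Reparam φ φ' τ u) (h' : HypPatch φ' U') (hu' : τ u ∈ U') :
    (firstForm φ u).det = jacDet τ u ^ 2 * (firstForm φ' (τ u)).det := by
  rw [firstForm_det, firstForm_det, r.pd_eq h' hu', r.pd_eq h' hu', jacDet]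
  simp only [lorentz_add_left, lorentz_add_right, lorentz_smul_left, lorentz_smul_right,
    lorentz_comm (pd φ' 1 (τ u)) (pd φ' 0 (τ u))]
  ring

theorem jacDet_ne_zero (r : Reparam φ φ' τ u) (h : HypPatch φ U) (hu : u ∈ U)
    (h' : HypPatch φ' U') (hu' : τ u ∈ U') : jacDet τ u ≠ 0 := by
  intro h0
  have := h.det_pos hu
  rw [r.det_eq h' hu', h0] at this
  simp at this

theorem sqrt_det_eq (r : Reparam φ φ' τ u) (h' : HypPatch φ' U') (hu' : τ u ∈ U') :
    √(firstForm φ u).det = |jacDet τ u| * √(firstForm φ' (τ u)).det := by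
  rw [r.det_eq h' hu', Real.sqrt_mul (sq_nonneg _), Real.sqrt_sq_eq_abs]

theorem unitNormal_eq (r : Reparam φ φ' τ u) (h : HypPatch φ U) (hu : u ∈ U)
    (h' : HypPatch φ' U') (hu' : τ u ∈ U') :
    unitNormal φ u = (|jacDet τ u|⁻¹ * jacDet τ u) • unitNormal φ' (τ u) := by
  rw [h.unitNormal_eq hu, h'.unitNormal_eq hu', r.sqrt_det_eq h' hu', r.pd_eq h' hu',
    r.pd_eq h' hu', r.apply_eq, cross3_reparam, smul_smul, smul_smul, jacDet, mul_inv]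
  congr 1
  ring

/-- By the chain rule, second derivatives of `τ` multiply only tangent vectors, which the normal
annihilates. The second fundamental form thus transforms as a tensor. -/
theorem lorentz_pd_pd (r : Reparam φ φ' τ u) (h' : HypPatch φ' U') (hu' : τ u ∈ U') (i j : Fin 2) :
    lorentz (pd (pd φ j) i u) (unitNormal φ' (τ u)) =
      jac τ u 0 j * (jac τ u 0 i * secondForm φ' (τ u) 0 0 + jac τ u 1 i * secondForm φ' (τ u) 1 0) +
      jac τ u 1 j * (jac τ u 0 i * secondForm φ' (τ u) 0 1 + jac τ u 1 i * secondForm φ' (τ u) 1 1)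
      := by
  have hev : pd φ j =ᶠ[nhds u] fun v =>
      jac τ v 0 j • (pd φ' 0 ∘ τ) v + jac τ v 1 j • (pd φ' 1 ∘ τ) v := by
    filter_upwards [r.eventually,
      r.differentiableAt.continuousAt.preimage_mem_nhds (h'.isOpen.mem_nhds hu')] with v hv hv'
    exact hv.pd_eq h' hv' j
  have hc : ∀ l, DifferentiableAt ℝ (pd φ' l ∘ τ) u := fun l =>
    (h'.differentiableAt_pd l hu').comp u r.differentiableAt
  have hJ := fun l => r.differentiableAt_jac j l
  have e : pd (pd φ j) i u =
      (jac τ u 0 j • fderiv ℝ (pd φ' 0 ∘ τ) u (EuclideanSpace.single i 1) +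
        fderiv ℝ (fun v => jac τ v 0 j) u (EuclideanSpace.single i 1) • pd φ' 0 (τ u)) +
      (jac τ u 1 j • fderiv ℝ (pd φ' 1 ∘ τ) u (EuclideanSpace.single i 1) +
        fderiv ℝ (fun v => jac τ v 1 j) u (EuclideanSpace.single i 1) • pd φ' 1 (τ u)) := by
    rw [pd, hev.fderiv_eq, fderiv_fun_add ((hJ 0).fun_smul (hc 0)) ((hJ 1).fun_smul (hc 1)),
      fderiv_fun_smul (hJ 0) (hc 0), fderiv_fun_smul (hJ 1) (hc 1)]
    simp
  rw [e, fderiv_comp_single r.differentiableAt (h'.differentiableAt_pd 0 hu'),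
    fderiv_comp_single r.differentiableAt (h'.differentiableAt_pd 1 hu')]
  simp only [lorentz_add_left, lorentz_smul_left, h'.pd_unitNormal hu', secondForm,
    Matrix.of_apply]
  simp only [pd]
  ring

/-- The unit normal changes by the sign `s` of the Jacobian determinant, and the mean curvature
changes by the same sign. -/
theorem patchMeanCurvature_sq (r : Reparam φ φ' τ u) (h : HypPatch φ U) (hu : u ∈ U)
    (h' : HypPatch φ' U') (hu' : τ u ∈ U') :
    patchMeanCurvature φ u ^ 2 = patchMeanCurvature φ' (τ u) ^ 2 := by
  have hJ := r.jacDet_ne_zero h hu h' hu'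
  have hD' := (h'.det_pos hu').ne'
  set s := |jacDet τ u|⁻¹ * jacDet τ u with hs
  have hs2 : s ^ 2 = 1 := by
    rw [hs, mul_pow, inv_pow, sq_abs, inv_mul_cancel₀ (pow_ne_zero 2 hJ)]
  have hsec : ∀ i j, secondForm φ u i j = s *
      (jac τ u 0 j * (jac τ u 0 i * secondForm φ' (τ u) 0 0 + jac τ u 1 i * secondForm φ' (τ u) 1 0)
      + jac τ u 1 j *
        (jac τ u 0 i * secondForm φ' (τ u) 0 1 + jac τ u 1 i * secondForm φ' (τ u) 1 1)) := by
    intro i j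
    rw [← r.lorentz_pd_pd h' hu', ← lorentz_smul_right, ← r.unitNormal_eq h hu h' hu']
    rfl
  have e := det_mul_patchMeanCurvature (h.det_pos hu).ne'
  have e' := det_mul_patchMeanCurvature hD'
  rw [hsec, hsec, hsec, hsec, r.det_eq h' hu', r.pd_eq h' hu', r.pd_eq h' hu'] at e
  simp only [lorentz_add_left, lorentz_add_right, lorentz_smul_left, lorentz_smul_right,
    lorentz_comm (pd φ' 1 (τ u)) (pd φ' 0 (τ u))] at e
  have key : patchMeanCurvature φ u = s * patchMeanCurvature φ' (τ u) := by
    refine mul_left_cancel₀ (mul_ne_zero (pow_ne_zero 2 hJ) hD') ?_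
    rw [jacDet] at e ⊢
    linear_combination (1 / 2) * e - (1 / 2) * s *
      (jac τ u 0 0 * jac τ u 1 1 - jac τ u 0 1 * jac τ u 1 0) ^ 2 * e'
  rw [key, mul_pow, hs2, one_mul]

theorem gradPair_eq (r : Reparam φ φ' τ u) (h : HypPatch φ U) (hu : u ∈ U)
    (h' : HypPatch φ' U') (hu' : τ u ∈ U') {χ χ' : Plane → ℝ} (hχ' : DifferentiableAt ℝ χ' (τ u))
    (hχ : χ =ᶠ[nhds u] χ' ∘ τ) (q : Mink) :
    gradPair φ u (partials χ u) (fun i => lorentz q (pd φ i u)) =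
      gradPair φ' (τ u) (partials χ' (τ u)) (fun i => lorentz q (pd φ' i (τ u))) := by
  have hJ := r.jacDet_ne_zero h hu h' hu'
  have hD' := (h'.det_pos hu').ne'
  have hp : ∀ i, partials χ u i =
      jac τ u 0 i * partials χ' (τ u) 0 + jac τ u 1 i * partials χ' (τ u) 1 := by
    intro i
    rw [partials, hχ.fderiv_eq, fderiv_comp_single r.differentiableAt hχ']
    rfl
  rw [gradPair, gradPair, r.det_eq h' hu', div_eq_div_iff (mul_ne_zero (pow_ne_zero 2 hJ) hD') hD']
  simp only [hp, r.pd_eq h' hu', lorentz_add_left, lorentz_add_right, lorentz_smul_left,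
    lorentz_smul_right, lorentz_comm (pd φ' 1 (τ u)) (pd φ' 0 (τ u)), jacDet]
  ring

end Reparam

/-! ### Charts and the area measure -/

section Charts

variable {M : Type*} [TopologicalSpace M] [ChartedSpace Plane M] [IsManifold (𝓡 2) ∞ M]
  {F : M → Mink} {e e' : OpenPartialHomeomorph M Plane}

theorem IsHypImmersion.hypPatch (hF : IsHypImmersion F) (he : e ∈ atlas Plane M) :
    HypPatch (F ∘ e.symm) e.target where
  isOpen := e.open_target
  contDiffOn := by
    rw [← contMDiffOn_iff_contDiffOn]
    exact hF.smooth.comp_contMDiffOn (contMDiffOn_symm_of_mem_maximalAtlas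
      (IsManifold.subset_maximalAtlas he))
  mem u _ := hF.mem _
  injective_fderiv u hu := by
    have hd : e.MDifferentiable (𝓡 2) (𝓡 2) :=
      mdifferentiable_of_mem_atlas (I := 𝓡 2) (M := M) he
    have h1 : MDifferentiableAt (𝓡 2) (𝓡 2) e.symm u := hd.mdifferentiableAt_symm hu
    have h2 : MDifferentiableAt (𝓡 2) 𝓘(ℝ, Mink) F (e.symm u) :=
      hF.smooth.mdifferentiableAt (by simp)
    rw [← mfderiv_eq_fderiv, mfderiv_comp u h2 h1]
    exact (hF.injective_mfderiv _).comp (hd.symm.mfderiv_injective hu)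

theorem IsHypImmersion.reparam (F : M → Mink) (he : e ∈ atlas Plane M) (he' : e' ∈ atlas Plane M)
    {u : Plane} (hu : u ∈ e.target) (hu' : e.symm u ∈ e'.source) :
    Reparam (F ∘ e.symm) (F ∘ e'.symm) (e' ∘ e.symm) u where
  contDiffAt := by
    have h1 : ContMDiffAt (𝓡 2) (𝓡 2) ∞ e.symm u :=
      (contMDiffOn_symm_of_mem_maximalAtlas
        (IsManifold.subset_maximalAtlas he)).contMDiffAt (e.open_target.mem_nhds hu)
    have h2 : ContMDiffAt (𝓡 2) (𝓡 2) ∞ e' (e.symm u) :=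
      (contMDiffOn_of_mem_maximalAtlas
        (IsManifold.subset_maximalAtlas he')).contMDiffAt (e'.open_source.mem_nhds hu')
    have h3 : ContDiffAt ℝ ∞ (e' ∘ e.symm) u := contMDiffAt_iff_contDiffAt.1 (h2.comp u h1)
    exact h3.of_le (WithTop.coe_le_coe.2 (le_top : (2 : ℕ∞) ≤ ⊤))
  eventuallyEq := by
    filter_upwards [(e.symm.continuousAt hu).preimage_mem_nhds (e'.open_source.mem_nhds hu')]
      with v hv
    simp only [Function.comp_apply]
    rw [e'.left_inv hv]

end Charts

/-! ### The area measure in a chart -/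

section ChartArea

variable {M : Type*} [TopologicalSpace M] [MeasurableSpace M] [BorelSpace M]

theorem aemeasurable_symm (e : OpenPartialHomeomorph M Plane) :
    AEMeasurable e.symm ((volume : Measure Plane).restrict e.target) :=
  e.continuousOn_symm.aemeasurable e.open_target.measurableSet

theorem measurableSet_target_inter_preimage (e : OpenPartialHomeomorph M Plane) {A : Set M}
    (hA : MeasurableSet A) : MeasurableSet (e.target ∩ e.symm ⁻¹' A) := by
  have h := (continuousOn_iff_continuous_domRestrict.1 e.continuousOn_symm).measurable hA
  have h2 := MeasurableSet.subtype_image e.open_target.measurableSet h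
  convert h2 using 1
  ext u
  simp [and_comm]

theorem aemeasurable_symm_withDensity (e : OpenPartialHomeomorph M Plane)
    (f : Plane → ENNReal) :
    AEMeasurable e.symm (((volume : Measure Plane).restrict e.target).withDensity f) :=
  (aemeasurable_symm e).mono_ac (withDensity_absolutelyContinuous _ f)

theorem chartArea_apply (F : M → Mink) (e : OpenPartialHomeomorph M Plane) {A : Set M}
    (hA : MeasurableSet A) :
    chartArea F e A = ∫⁻ u in e.target ∩ e.symm ⁻¹' A,
      ENNReal.ofReal (√(firstForm (F ∘ e.symm) u).det) := by
  rw [chartArea, Measure.map_apply_of_aemeasurable (aemeasurable_symm_withDensity e _) hA,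
    withDensity_apply', Measure.restrict_restrict' e.open_target.measurableSet, Set.inter_comm]

theorem chartArea_compl_source (F : M → Mink) (e : OpenPartialHomeomorph M Plane) :
    chartArea F e e.sourceᶜ = 0 := by
  rw [chartArea_apply F e e.open_source.measurableSet.compl]
  have : e.target ∩ e.symm ⁻¹' e.sourceᶜ = ∅ := by
    ext u
    simp only [Set.mem_inter_iff, Set.mem_preimage, Set.mem_compl_iff, Set.mem_empty_iff_false,
      iff_false, not_and, not_not]
    exact fun hu => e.map_target hu
  rw [this, Measure.restrict_empty, lintegral_zero_measure]

variable [ChartedSpace Plane M] [IsManifold (𝓡 2) ∞ M]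
  {F : M → Mink} {e e' : OpenPartialHomeomorph M Plane}

/-- The area measures of two charts agree on the overlap. -/
theorem IsHypImmersion.chartArea_eq (hF : IsHypImmersion F) (he : e ∈ atlas Plane M)
    (he' : e' ∈ atlas Plane M) {A : Set M} (hA : MeasurableSet A) (hAe : A ⊆ e.source)
    (hAe' : A ⊆ e'.source) : chartArea F e A = chartArea F e' A := by
  rw [chartArea_apply F e hA, chartArea_apply F e' hA]
  set s := e.target ∩ e.symm ⁻¹' A with hs
  have him : (e' ∘ e.symm) '' s = e'.target ∩ e'.symm ⁻¹' A := by
    ext v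
    constructor
    · rintro ⟨u, ⟨hu, huA⟩, rfl⟩
      refine ⟨e'.map_source (hAe' huA), ?_⟩
      simp only [Set.mem_preimage, Function.comp_apply]
      rwa [e'.left_inv (hAe' huA)]
    · rintro ⟨hv, hvA⟩
      refine ⟨e (e'.symm v), ⟨e.map_source (hAe hvA), ?_⟩, ?_⟩
      · simp only [Set.mem_preimage]
        rwa [e.left_inv (hAe hvA)]
      · simp only [Function.comp_apply]
        rw [e.left_inv (hAe hvA), e'.right_inv hv]
  have hrep : ∀ u ∈ s, Reparam (F ∘ e.symm) (F ∘ e'.symm) (e' ∘ e.symm) u := fun u hu =>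
    IsHypImmersion.reparam F he he' hu.1 (hAe' hu.2)
  have hinj : Set.InjOn (e' ∘ e.symm) s := by
    intro u hu v hv huv
    exact e.symm.injOn hu.1 hv.1 (e'.injOn (hAe' hu.2) (hAe' hv.2) huv)
  have hm := measurableSet_target_inter_preimage e hA
  rw [← him, lintegral_image_eq_lintegral_abs_det_fderiv_mul volume hm
    (fun u hu => (hrep u hu).differentiableAt.hasFDerivAt.hasFDerivWithinAt) hinj]
  refine setLIntegral_congr_fun hm fun u hu => ?_
  rw [det_fderiv_eq_jacDet, ← ENNReal.ofReal_mul (abs_nonneg _),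
    ← (hrep u hu).sqrt_det_eq (hF.hypPatch he') (e'.map_source (hAe' hu.2))]

/-- On the domain of a chart, the area measure is the area measure of that chart. -/
theorem IsHypImmersion.areaMeasure_restrict (hF : IsHypImmersion F) (he : e ∈ atlas Plane M) :
    (areaMeasure F).restrict e.source = chartArea F e := by
  have hms := e.open_source.measurableSet
  apply le_antisymm
  -- The area of `e`, plus infinite mass off its domain, dominates every chart area and hence their
  -- supremum. Restricting to the domain removes the infinite part.
  · have hle : areaMeasure F ≤ chartArea F e + (⊤ : Measure M).restrict e.sourceᶜ := by
      refine iSup₂_le fun e' he' => Measure.le_intro fun A hA _ => ?_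
      rw [← measure_inter_add_sdiff A hms, Measure.add_apply, Measure.restrict_apply hA]
      refine add_le_add ?_ (Measure.le_iff'.1 le_top _)
      · have hm : MeasurableSet ((A ∩ e.source) ∩ e'.source) :=
          (hA.inter hms).inter e'.open_source.measurableSet
        have h0 : chartArea F e' ((A ∩ e.source) \ e'.source) = 0 :=
          measure_mono_null (fun x hx => hx.2) (chartArea_compl_source F e')
        rw [← measure_inter_add_sdiff (A ∩ e.source) e'.open_source.measurableSet, h0, add_zero,
          hF.chartArea_eq he' he hm (fun x hx => hx.2) (fun x hx => hx.1.2)]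
        exact measure_mono fun x hx => hx.1.1
    refine (Measure.restrict_mono le_rfl hle).trans ?_
    rw [Measure.restrict_add, Measure.restrict_restrict hms, Set.inter_compl_self,
      Measure.restrict_empty, add_zero]
    exact Measure.restrict_le_self
  · have hle : chartArea F e ≤ areaMeasure F := le_iSup₂_of_le e he le_rfl
    have : chartArea F e = (chartArea F e).restrict e.source := by
      symm
      apply Measure.restrict_eq_self_of_ae_mem
      rw [ae_iff]
      exact chartArea_compl_source F e
    rw [this]
    exact Measure.restrict_mono le_rfl hle

/-- The density √(det g) is continuous, hence integrable over compact coordinate sets. With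
compactness of `M` this gives finite area and integrability of continuous functions. -/
theorem IsHypImmersion.isLocallyFiniteMeasure (hF : IsHypImmersion F) :
    IsLocallyFiniteMeasure (areaMeasure F) := by
  refine ⟨fun x => ?_⟩
  set e := chartAt Plane x with hedef
  have he : e ∈ atlas Plane M := chart_mem_atlas Plane x
  have hx : x ∈ e.source := mem_chart_source Plane x
  obtain ⟨K, hK, hKn, hKt⟩ := exists_compact_subset e.open_target (e.map_source hx)
  refine ⟨e.source ∩ e ⁻¹' interior K, ?_, ?_⟩
  · exact (e.isOpen_inter_preimage isOpen_interior).mem_nhds ⟨hx, hKn⟩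
  · have hm := (e.isOpen_inter_preimage (isOpen_interior (s := K))).measurableSet
    have h1 : areaMeasure F (e.source ∩ e ⁻¹' interior K) =
        chartArea F e (e.source ∩ e ⁻¹' interior K) := by
      rw [← hF.areaMeasure_restrict he, Measure.restrict_apply hm]
      congr 1
      ext y; simp; tauto
    rw [h1, chartArea_apply F e hm]
    refine lt_of_le_of_lt (lintegral_mono_set (t := K) ?_) ?_
    · rintro u ⟨hu, -, hu2⟩
      simp only [Set.mem_preimage] at hu2
      rw [e.right_inv hu] at hu2
      exact interior_subset hu2
    · have hc : ContinuousOn (fun u => √(firstForm (F ∘ e.symm) u).det) K :=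
        ((hF.hypPatch he).contDiffOn_sqrt_det.continuousOn).mono hKt
      have hi : IntegrableOn (fun u => √(firstForm (F ∘ e.symm) u).det) K :=
        hc.integrableOn_compact hK
      exact hi.lintegral_lt_top

/-- The area integral of a function that vanishes off a chart domain, in coordinates. -/
theorem IsHypImmersion.integral_eq (hF : IsHypImmersion F) (he : e ∈ atlas Plane M) {f : M → ℝ}
    (hf : Continuous f) (h0 : ∀ x ∉ e.source, f x = 0) :
    ∫ x, f x ∂(areaMeasure F) =
      ∫ u in e.target, √(firstForm (F ∘ e.symm) u).det * f (e.symm u) := by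
  have hms := e.open_source.measurableSet
  have hD : AEMeasurable (fun u => ENNReal.ofReal √(firstForm (F ∘ e.symm) u).det)
      ((volume : Measure Plane).restrict e.target) :=
    ((hF.hypPatch he).contDiffOn_sqrt_det.continuousOn.aemeasurable
      e.open_target.measurableSet).ennreal_ofReal
  rw [← setIntegral_eq_integral_of_forall_compl_eq_zero h0, hF.areaMeasure_restrict he, chartArea,
    integral_map (aemeasurable_symm_withDensity e _) hf.measurable.aestronglyMeasurable,
    integral_withDensity_eq_integral_toReal_smul₀ hD (by simp)]
  simp [ENNReal.toReal_ofReal (Real.sqrt_nonneg _)]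

theorem IsHypImmersion.lintegral_chart_le (hF : IsHypImmersion F) (he : e ∈ atlas Plane M)
    {f : M → ENNReal} (hf : Measurable f) :
    ∫⁻ u in e.target, ENNReal.ofReal (√(firstForm (F ∘ e.symm) u).det) * f (e.symm u) ≤
      ∫⁻ x, f x ∂(areaMeasure F) := by
  have hD : AEMeasurable (fun u => ENNReal.ofReal √(firstForm (F ∘ e.symm) u).det)
      ((volume : Measure Plane).restrict e.target) :=
    ((hF.hypPatch he).contDiffOn_sqrt_det.continuousOn.aemeasurable
      e.open_target.measurableSet).ennreal_ofReal
  calc _ = ∫⁻ x, f x ∂(chartArea F e) := by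
        rw [chartArea, lintegral_map' hf.aemeasurable (aemeasurable_symm_withDensity e _),
          lintegral_withDensity_eq_lintegral_mul₀ hD (g := fun u => f (e.symm u))
            (hf.comp_aemeasurable (aemeasurable_symm e))]
        rfl
    _ ≤ _ := by
        rw [← hF.areaMeasure_restrict he]
        exact lintegral_mono' Measure.restrict_le_self le_rfl

end ChartArea

/-! ### The divergence theorem on a closed surface -/

/-- Displays linearity in `a`, which lets the pairing be summed over a partition of unity. -/
theorem gradPair_eq_sum (φ : Plane → Mink) (u : Plane) (a b : Fin 2 → ℝ) :
    gradPair φ u a b =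
      a 0 * ((lorentz (pd φ 1 u) (pd φ 1 u) * b 0 - lorentz (pd φ 0 u) (pd φ 1 u) * b 1) /
        (firstForm φ u).det) +
      a 1 * ((lorentz (pd φ 0 u) (pd φ 0 u) * b 1 - lorentz (pd φ 0 u) (pd φ 1 u) * b 0) /
        (firstForm φ u).det) := by
  rw [gradPair]; ring

theorem HypPatch.continuousOn_gradPair {φ : Plane → Mink} {U : Set Plane} (h : HypPatch φ U)
    {χ : Plane → ℝ} (hχ : ContDiffOn ℝ ∞ χ U) (q : Mink) :
    ContinuousOn (fun u => gradPair φ u (partials χ u) (fun i => lorentz q (pd φ i u))) U := by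
  simp only [gradPair_eq_sum]
  have hp : ∀ i, ContinuousOn (fun u => partials χ u i) U := fun i =>
    (hχ.continuousOn_fderiv_of_isOpen h.isOpen (by simp)).clm_apply continuousOn_const
  have hg := fun i j => (h.contDiffOn_lorentz_pd i j).continuousOn
  have hq := fun i => (h.contDiffOn_lorentz_const_pd q i).continuousOn
  have hD := h.contDiffOn_det.continuousOn
  have hne : ∀ u ∈ U, (firstForm φ u).det ≠ 0 := fun u hu => (h.det_pos hu).ne'
  exact ((hp 0).mul ((((hg 1 1).mul (hq 0)).sub ((hg 0 1).mul (hq 1))).div hD hne)).add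
    ((hp 1).mul ((((hg 0 0).mul (hq 1)).sub ((hg 0 1).mul (hq 0))).div hD hne))

section Global

variable {M : Type*} [TopologicalSpace M] [ChartedSpace Plane M]

/-- The Riemannian inner product of the gradients of `ρ` and of `⟨q, F⟩`. -/
noncomputable def surfaceGradPair (F : M → Mink) (ρ : M → ℝ) (q : Mink) (x : M) : ℝ :=
  gradPair (F ∘ (chartAt Plane x).symm) (chartAt Plane x x)
    (partials (ρ ∘ (chartAt Plane x).symm) (chartAt Plane x x))
    (fun i => lorentz q (pd (F ∘ (chartAt Plane x).symm) i (chartAt Plane x x)))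

/-- The preferred chart at x may jump with x, so continuity of quantities defined through it is not
immediate. Once they are known to be chart independent, it can be checked in one fixed chart near
each point. -/
theorem continuous_of_chart {f : M → ℝ} (g : OpenPartialHomeomorph M Plane → Plane → ℝ)
    (hg : ∀ e ∈ atlas Plane M, ContinuousOn (g e) e.target)
    (hf : ∀ e ∈ atlas Plane M, ∀ x ∈ e.source, f x = g e (e x)) : Continuous f := by
  rw [continuous_iff_continuousAt]
  intro x
  have he := chart_mem_atlas Plane x
  have hc : ContinuousOn (fun y => g (chartAt Plane x) (chartAt Plane x y))
      (chartAt Plane x).source :=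
    (hg _ he).comp (chartAt Plane x).continuousOn fun y hy => (chartAt Plane x).map_source hy
  exact (hc.congr fun y hy => hf _ he y hy).continuousAt
    ((chartAt Plane x).open_source.mem_nhds (mem_chart_source Plane x))

theorem surfaceGradPair_of_notMem_tsupport (F : M → Mink) {ρ : M → ℝ} (q : Mink) {x : M}
    (hx : x ∉ tsupport ρ) : surfaceGradPair F ρ q x = 0 := by
  have hev : ρ ∘ (chartAt Plane x).symm =ᶠ[nhds (chartAt Plane x x)] fun _ => 0 := by
    have hxx : (chartAt Plane x).symm (chartAt Plane x x) = x :=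
      (chartAt Plane x).left_inv (mem_chart_source Plane x)
    have h1 : ∀ᶠ y in nhds ((chartAt Plane x).symm (chartAt Plane x x)), ρ y = 0 := by
      rw [hxx]
      exact notMem_tsupport_iff_eventuallyEq.1 hx
    exact ((chartAt Plane x).symm.continuousAt
      ((chartAt Plane x).map_source (mem_chart_source Plane x))).eventually h1
  rw [surfaceGradPair, gradPair_eq_sum]
  simp only [partials, hev.fderiv_eq]
  simp

variable [IsManifold (𝓡 2) ∞ M] {F : M → Mink} {e : OpenPartialHomeomorph M Plane}

theorem contDiffOn_comp_symm {ρ : M → ℝ} (hρ : ContMDiff (𝓡 2) 𝓘(ℝ) ∞ ρ)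
    (he : e ∈ atlas Plane M) : ContDiffOn ℝ ∞ (ρ ∘ e.symm) e.target := by
  rw [← contMDiffOn_iff_contDiffOn]
  exact hρ.comp_contMDiffOn (contMDiffOn_symm_of_mem_maximalAtlas
    (IsManifold.subset_maximalAtlas he))

theorem IsHypImmersion.reparam_chartAt (F : M → Mink) (he : e ∈ atlas Plane M) {x : M}
    (hx : x ∈ e.source) : Reparam (F ∘ e.symm) (F ∘ (chartAt Plane x).symm)
      (chartAt Plane x ∘ e.symm) (e x) ∧ (chartAt Plane x ∘ e.symm) (e x) = chartAt Plane x x := by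
  have hxx : e.symm (e x) = x := e.left_inv hx
  refine ⟨IsHypImmersion.reparam F he (chart_mem_atlas Plane x) (e.map_source hx) ?_, ?_⟩
  · rw [hxx]; exact mem_chart_source Plane x
  · simp [hxx]

theorem IsHypImmersion.meanCurvature_sq (hF : IsHypImmersion F) (he : e ∈ atlas Plane M) {x : M}
    (hx : x ∈ e.source) :
    meanCurvature F x ^ 2 = patchMeanCurvature (F ∘ e.symm) (e x) ^ 2 := by
  obtain ⟨r, hr⟩ := IsHypImmersion.reparam_chartAt F he hx
  have hm : chartAt Plane x x ∈ (chartAt Plane x).target :=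
    (chartAt Plane x).map_source (mem_chart_source Plane x)
  rw [r.patchMeanCurvature_sq (hF.hypPatch he) (e.map_source hx)
    (hF.hypPatch (chart_mem_atlas Plane x)) (by rw [hr]; exact hm), hr]
  rfl

theorem IsHypImmersion.surfaceGradPair_eq (hF : IsHypImmersion F) (he : e ∈ atlas Plane M) {x : M}
    (hx : x ∈ e.source) {ρ : M → ℝ} (hρ : ContMDiff (𝓡 2) 𝓘(ℝ) ∞ ρ) (q : Mink) :
    surfaceGradPair F ρ q x = gradPair (F ∘ e.symm) (e x) (partials (ρ ∘ e.symm) (e x))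
      (fun i => lorentz q (pd (F ∘ e.symm) i (e x))) := by
  obtain ⟨r, hr⟩ := IsHypImmersion.reparam_chartAt F he hx
  have hm : chartAt Plane x x ∈ (chartAt Plane x).target :=
    (chartAt Plane x).map_source (mem_chart_source Plane x)
  have hc := contDiffOn_comp_symm hρ (chart_mem_atlas Plane x)
  have hxx : e.symm (e x) = x := e.left_inv hx
  rw [r.gradPair_eq (hF.hypPatch he) (e.map_source hx)
    (hF.hypPatch (chart_mem_atlas Plane x)) (by rw [hr]; exact hm)
    (χ := ρ ∘ e.symm) (χ' := ρ ∘ (chartAt Plane x).symm), hr]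
  · rfl
  · rw [hr]
    exact (hc.contDiffAt ((chartAt Plane x).open_target.mem_nhds hm)).differentiableAt (by simp)
  · have : (chartAt Plane x).source ∈ nhds (e.symm (e x)) := by
      rw [hxx]; exact (chartAt Plane x).open_source.mem_nhds (mem_chart_source Plane x)
    filter_upwards [(e.symm.continuousAt (e.map_source hx)).preimage_mem_nhds this] with v hv
    simp only [Function.comp_apply]
    rw [(chartAt Plane x).left_inv hv]

theorem IsHypImmersion.continuous_meanCurvature_sq (hF : IsHypImmersion F) :
    Continuous fun x => meanCurvature F x ^ 2 :=
  continuous_of_chart (fun e u => patchMeanCurvature (F ∘ e.symm) u ^ 2)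
    (fun _ he => (hF.hypPatch he).continuousOn_patchMeanCurvature.pow 2)
    (fun _ he _ hx => hF.meanCurvature_sq he hx)

theorem IsHypImmersion.continuous_surfaceGradPair (hF : IsHypImmersion F) {ρ : M → ℝ}
    (hρ : ContMDiff (𝓡 2) 𝓘(ℝ) ∞ ρ) (q : Mink) : Continuous (surfaceGradPair F ρ q) :=
  continuous_of_chart (fun e u => gradPair (F ∘ e.symm) u (partials (ρ ∘ e.symm) u)
      (fun i => lorentz q (pd (F ∘ e.symm) i u)))
    (fun _ he => (hF.hypPatch he).continuousOn_gradPair (contDiffOn_comp_symm hρ he) q)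
    (fun _ he _ hx => hF.surfaceGradPair_eq he hx hρ q)

/-- The gradients of a partition of unity sum to the gradient of 1, so the error terms from
localizing the divergence theorem cancel. -/
theorem sum_surfaceGradPair_eq_zero (F : M → Mink) {ι : Type*} [Fintype ι] {ρ : ι → M → ℝ}
    (hρ : ∀ i, ContMDiff (𝓡 2) 𝓘(ℝ) ∞ (ρ i)) (hsum : ∀ x, ∑ i, ρ i x = 1) (q : Mink) (x : M) :
    ∑ i, surfaceGradPair F (ρ i) q x = 0 := by
  have hp : ∀ j, ∑ i, partials (ρ i ∘ (chartAt Plane x).symm) (chartAt Plane x x) j = 0 := by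
    intro j
    have hd : ∀ i ∈ Finset.univ, DifferentiableAt ℝ (ρ i ∘ (chartAt Plane x).symm)
        (chartAt Plane x x) := fun i _ =>
      ((contDiffOn_comp_symm (hρ i) (chart_mem_atlas Plane x)).contDiffAt
        ((chartAt Plane x).open_target.mem_nhds ((chartAt Plane x).map_source
          (mem_chart_source Plane x)))).differentiableAt (by simp)
    have h1 := fderiv_fun_sum hd
    have h2 : (fun u => ∑ i, (ρ i ∘ (chartAt Plane x).symm) u) = fun _ => 1 := by
      funext u; exact hsum _
    rw [h2] at h1
    have := congrArg (fun L : Plane →L[ℝ] ℝ => L (EuclideanSpace.single j 1)) h1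
    simpa [partials] using this.symm
  simp only [surfaceGradPair, gradPair_eq_sum]
  rw [Finset.sum_add_distrib, ← Finset.sum_mul, ← Finset.sum_mul, hp, hp]
  ring

variable [CompactSpace M]

variable (M) in
theorem exists_finite_partition [T2Space M] : ∃ (t : Finset M) (ρ : t → M → ℝ),
    (∀ i, ContMDiff (𝓡 2) 𝓘(ℝ) ∞ (ρ i)) ∧ (∀ i x, 0 ≤ ρ i x) ∧ (∀ x, ∑ i, ρ i x = 1) ∧
    ∀ i, tsupport (ρ i) ⊆ (chartAt Plane (i : M)).source := by
  obtain ⟨t, -, ht⟩ := isCompact_univ.elim_nhds_subcover (fun x : M => (chartAt Plane x).source)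
    fun x _ => (chartAt Plane x).open_source.mem_nhds (mem_chart_source Plane x)
  obtain ⟨ρ, hρ⟩ := SmoothPartitionOfUnity.exists_isSubordinate (𝓡 2) (isClosed_univ (X := M))
    (fun i : t => (chartAt Plane (i : M)).source) (fun i => (chartAt Plane (i : M)).open_source)
    (by simpa [Set.iUnion_subtype] using ht)
  refine ⟨t, fun i => ρ i, fun i => (ρ i).contMDiff, fun i x => ρ.nonneg i x, fun x => ?_,
    fun i => hρ i⟩
  rw [← finsum_eq_sum_of_fintype]
  exact ρ.sum_eq_one (Set.mem_univ x)

variable [MeasurableSpace M] [BorelSpace M]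

theorem IsHypImmersion.integrable_of_continuous (hF : IsHypImmersion F) {f : M → ℝ}
    (hf : Continuous f) : Integrable f (areaMeasure F) := by
  have := hF.isLocallyFiniteMeasure
  exact hf.integrable_of_hasCompactSupport (HasCompactSupport.of_compactSpace f)

/-- If `B` bounds the divergence of `k(f) ∇f` from below, where `f = ⟨q, F⟩`, then `∫ B ≤ 0`. -/
theorem IsHypImmersion.integral_nonpos [T2Space M] (hF : IsHypImmersion F) (q : Mink) {k : ℝ → ℝ} {T : Set ℝ}
    (hT : IsOpen T) (hk : ContDiffOn ℝ 1 k T) (hfT : ∀ x, lorentz q (F x) ∈ T) {B : M → ℝ}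
    (hB : Continuous B)
    -- Here `n` stands for ⟨q, ν⟩. The signs of H and ν depend on the chart, so the bound is asked
    -- for both signs of H and for every `n`.
    (hle : ∀ x H n, H ^ 2 = meanCurvature F x ^ 2 →
      B x ≤ k (lorentz q (F x)) * (2 * lorentz q (F x) + 2 * H * n) +
        deriv k (lorentz q (F x)) * (lorentz q q + lorentz q (F x) ^ 2 - n ^ 2)) :
    ∫ x, B x ∂(areaMeasure F) ≤ 0 := by
  obtain ⟨t, ρ, hρ, hρ0, hρ1, hρs⟩ := exists_finite_partition M
  have hkc : Continuous fun x => k (lorentz q (F x)) :=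
    hk.continuousOn.comp_continuous
      (continuous_lorentz.comp (continuous_const.prodMk hF.smooth.continuous)) hfT
  -- Each `w i` is bounded by the divergence of ρᵢ k(f) ∇f, which lives in one chart and integrates
  -- to zero, while the `w i` sum to `B`.
  set w : t → M → ℝ := fun i x =>
    ρ i x * B x + k (lorentz q (F x)) * surfaceGradPair F (ρ i) q x with hw
  have hwc : ∀ i, Continuous (w i) := fun i =>
    ((hρ i).continuous.mul hB).add (hkc.mul (hF.continuous_surfaceGradPair (hρ i) q))
  have hsum : ∀ x, ∑ i, w i x = B x := by
    intro x
    simp only [hw]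
    rw [Finset.sum_add_distrib, ← Finset.sum_mul, ← Finset.mul_sum, hρ1,
      sum_surfaceGradPair_eq_zero F hρ hρ1]
    ring
  simp only [← hsum]
  rw [integral_finsetSum _ fun i _ => hF.integrable_of_continuous (hwc i)]
  refine Finset.sum_nonpos fun i _ => ?_
  set e := chartAt Plane (i : M) with hedef
  have he : e ∈ atlas Plane M := chart_mem_atlas Plane _
  have hts : ∀ x ∉ tsupport (ρ i), w i x = 0 := by
    intro x hx
    simp only [hw]
    rw [surfaceGradPair_of_notMem_tsupport F q hx, image_eq_zero_of_notMem_tsupport hx]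
    ring
  rw [hF.integral_eq he (hwc i) fun x hx => hts x fun h => hx (hρs i h)]
  set K := e '' tsupport (ρ i) with hKdef
  have hK : IsCompact K :=
    (isClosed_tsupport (ρ i)).isCompact.image_of_continuousOn (e.continuousOn.mono (hρs i))
  have hKt : K ⊆ e.target := by
    rintro _ ⟨x, hx, rfl⟩
    exact e.map_source (hρs i hx)
  have hnotK : ∀ u ∈ e.target, u ∉ K → e.symm u ∉ tsupport (ρ i) := by
    intro u hu huK hx
    exact huK ⟨e.symm u, hx, e.right_inv hu⟩
  have hP := hF.hypPatch he
  obtain ⟨hint, hzero⟩ := hP.integral_div_eq_zero hK hKt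
    ((contDiffOn_comp_symm (hρ i) he).of_le (WithTop.coe_le_coe.2 (le_top : (1 : ℕ∞) ≤ ⊤)))
    (fun u hu huK => image_eq_zero_of_notMem_tsupport (f := ρ i) (x := e.symm u)
      (hnotK u hu huK)) q hT hk
    (fun u _ => hfT (e.symm u))
  rw [← hzero]
  refine setIntegral_mono_on ?_ hint e.open_target.measurableSet fun u hu => ?_
  · have hc : ContinuousOn (fun u => √(firstForm (F ∘ e.symm) u).det * w i (e.symm u)) e.target :=
      hP.contDiffOn_sqrt_det.continuousOn.mul ((hwc i).comp_continuousOn e.continuousOn_symm)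
    refine ((hc.mono hKt).integrableOn_compact hK).of_forall_sdiff_eq_zero
      e.open_target.measurableSet fun u hu => ?_
    rw [hts _ (hnotK u hu.1 hu.2), mul_zero]
  · refine mul_le_mul_of_nonneg_left ?_ (Real.sqrt_nonneg _)
    have hx := e.map_target hu
    have hxx := e.right_inv hu
    simp only [hw]
    rw [hF.surfaceGradPair_eq he hx (hρ i) q, hxx]
    have h2 := hF.meanCurvature_sq he hx
    rw [hxx] at h2
    refine add_le_add (mul_le_mul_of_nonneg_left ?_ (hρ0 i _)) le_rfl
    exact hle _ _ _ h2.symm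

end Global

/-! ### The radial test function -/

/-- Squaring the positive part makes it C¹; this is why the radial weight contains the square of the
cutoff. -/
theorem hasDerivAt_max_zero_sq (z : ℝ) : HasDerivAt (fun z : ℝ => max z 0 ^ 2) (2 * max z 0) z := by
  rcases lt_trichotomy z 0 with h | h | h
  · have : (fun z : ℝ => max z 0 ^ 2) =ᶠ[nhds z] fun _ => 0 := by
      filter_upwards [gt_mem_nhds h] with x hx
      simp [max_eq_right hx.le]
    rw [max_eq_right h.le, mul_zero]
    exact (hasDerivAt_const z (0 : ℝ)).congr_of_eventuallyEq this
  · subst h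
    rw [max_self, mul_zero, hasDerivAt_iff_isLittleO_nhds_zero]
    have hO : (fun h : ℝ => max (0 + h) 0 ^ 2 - max 0 0 ^ 2 - h • (0 : ℝ)) =O[nhds 0]
        fun h : ℝ => h ^ 2 := by
      refine Asymptotics.IsBigO.of_bound 1 (Filter.Eventually.of_forall fun h => ?_)
      simp only [zero_add, max_self, smul_zero, sub_zero, Real.norm_eq_abs, one_mul, ne_eq,
        OfNat.ofNat_ne_zero, not_false_eq_true, zero_pow, abs_pow]
      refine pow_le_pow_left₀ (abs_nonneg _) ?_ 2
      rcases le_total h 0 with h0 | h0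
      · simp [h0]
      · simp [h0]
    exact hO.trans_isLittleO (Asymptotics.isLittleO_pow_id (by norm_num))
  · have : (fun z : ℝ => max z 0 ^ 2) =ᶠ[nhds z] fun z => z ^ 2 := by
      filter_upwards [lt_mem_nhds h] with x hx
      rw [max_eq_left hx.le]
    rw [max_eq_left h.le]
    simpa using (hasDerivAt_pow 2 z).congr_of_eventuallyEq this

theorem contDiff_max_zero_sq : ContDiff ℝ 1 fun z : ℝ => max z 0 ^ 2 := by
  rw [contDiff_one_iff_deriv]
  refine ⟨fun z => (hasDerivAt_max_zero_sq z).differentiableAt, ?_⟩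
  have : deriv (fun z : ℝ => max z 0 ^ 2) = fun z => 2 * max z 0 :=
    funext fun z => (hasDerivAt_max_zero_sq z).deriv
  rw [this]
  fun_prop

/-- The cutoff `(1 - sinh² r / S)₊` as a function of `t = cosh r`. -/
noncomputable def cutoff (S t : ℝ) : ℝ := max (1 - (t ^ 2 - 1) / S) 0

/-- The radial weight `(1 - sinh² r / S)₊² / (sinh² r + c)` as a function of `t = cosh r`. -/
noncomputable def radialWeight (S c t : ℝ) : ℝ := cutoff S t ^ 2 / (t ^ 2 - 1 + c)

theorem cutoff_nonneg (S t : ℝ) : 0 ≤ cutoff S t := le_max_right _ _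

theorem continuous_cutoff (S : ℝ) : Continuous (cutoff S) := by
  unfold cutoff; fun_prop

theorem contDiffOn_radialWeight (S c : ℝ) :
    ContDiffOn ℝ 1 (radialWeight S c) {t | 0 < t ^ 2 - 1 + c} := by
  refine ContDiffOn.div ?_ (by fun_prop) fun t ht => ne_of_gt ht
  exact (contDiff_max_zero_sq.comp (by fun_prop : ContDiff ℝ 1 fun t : ℝ =>
    1 - (t ^ 2 - 1) / S)).contDiffOn

theorem deriv_radialWeight (S : ℝ) {c t : ℝ} (ht : 0 < t ^ 2 - 1 + c) :
    deriv (radialWeight S c) t = -(4 * t * cutoff S t / (S * (t ^ 2 - 1 + c)) +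
      2 * t * cutoff S t ^ 2 / (t ^ 2 - 1 + c) ^ 2) := by
  have h0 : HasDerivAt (fun t : ℝ => t ^ 2 - 1) (2 * t) t := by
    simpa using (hasDerivAt_pow 2 t).sub_const 1
  have h1 : HasDerivAt (fun t : ℝ => cutoff S t ^ 2) (2 * cutoff S t * (-(2 * t / S))) t :=
    HasDerivAt.comp (h₂ := fun z : ℝ => max z 0 ^ 2) t (hasDerivAt_max_zero_sq _)
      ((h0.div_const S).const_sub 1)
  have h2 := h1.div (h0.add_const c) ht.ne'
  have h3 : HasDerivAt (radialWeight S c) _ t := h2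
  rw [h3.deriv]
  -- For `S = 0`, division by zero makes the cutoff constantly 1 and the first term 0, so the
  -- formula persists.
  rcases eq_or_ne S 0 with hS | hS
  · subst hS; simp; field_simp
  · field_simp
    ring

/-- The pointwise heart of the monotonicity inequality, with t = cosh r and n = ⟨q, ν⟩. The terms in
n and H complete to a square at the price of H²/4 times the squared cutoff, before the overall
factor 2. What remains is nonnegative because t ≥ 1. -/
theorem radialWeight_bound {S c t : ℝ} (hS : 0 < S) (hc : 0 < c) (ht : 1 ≤ t) (H n : ℝ) :
    2 * (c * cutoff S t ^ 2 / (t ^ 2 - 1 + c) ^ 2 - 2 / S * (t * cutoff S t)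
      - 1 / 4 * (H ^ 2 * cutoff S t ^ 2)) ≤
    radialWeight S c t * (2 * t + 2 * H * n) +
      deriv (radialWeight S c) t * (-1 + t ^ 2 - n ^ 2) := by
  have hs : 0 ≤ t ^ 2 - 1 := by nlinarith
  have hsc : 0 < t ^ 2 - 1 + c := by linarith
  rw [deriv_radialWeight S hsc, radialWeight]
  set s := t ^ 2 - 1 with hsdef
  have hst : -1 + t ^ 2 - n ^ 2 = s - n ^ 2 := by rw [hsdef]; ring
  rw [hst]
  have hy := cutoff_nonneg S t
  set y := cutoff S t with hydef
  set d := (s + c)⁻¹ with hd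
  have hdpos : 0 < d := inv_pos.2 hsc
  have hdm : (s + c) * d = 1 := mul_inv_cancel₀ hsc.ne'
  -- The difference of the two sides as a sum of visibly nonnegative terms.
  have e : y ^ 2 / (s + c) * (2 * t + 2 * H * n) +
      -(4 * t * y / (S * (s + c)) + 2 * t * y ^ 2 / (s + c) ^ 2) * (s - n ^ 2) -
      2 * (c * y ^ 2 / (s + c) ^ 2 - 2 / S * (t * y) - 1 / 4 * (H ^ 2 * y ^ 2)) =
      2 * (t - 1) * (c * y ^ 2 * d ^ 2) + 4 * t * y / S * (c * d) + n ^ 2 * (4 * t * y / S * d) +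
      2 * (t - 1) * (n * y * d) ^ 2 + 2 * (n * y * d + H * y / 2) ^ 2 := by
    rw [hd]
    field_simp
    ring
  have hpos : 0 ≤ 2 * (t - 1) * (c * y ^ 2 * d ^ 2) + 4 * t * y / S * (c * d) +
      n ^ 2 * (4 * t * y / S * d) +
      2 * (t - 1) * (n * y * d) ^ 2 + 2 * (n * y * d + H * y / 2) ^ 2 := by
    have : 0 ≤ t - 1 := by linarith
    positivity
  linarith

/-- Write sinh R = 2hC with h = sinh(R/2), C = cosh(R/2). The maximum of t · cutoff is at most
3C²/2, so the quotient is at most 3/(4h²), and h ≥ R/2. The bound thus has Euclidean form at every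
scale R. -/
theorem mul_cutoff_le {R t : ℝ} (hR : 0 < R) (ht : 1 ≤ t) :
    2 / Real.sinh R ^ 2 * (t * cutoff (Real.sinh R ^ 2) t) ≤ 3 / R ^ 2 := by
  have hC := Real.one_le_cosh (R / 2)
  have hh : R / 2 ≤ Real.sinh (R / 2) := Real.self_le_sinh_iff.2 (by positivity)
  have hsq := Real.cosh_sq (R / 2)
  have hS : Real.sinh R ^ 2 = 4 * Real.sinh (R / 2) ^ 2 * Real.cosh (R / 2) ^ 2 := by
    have : Real.sinh R = 2 * Real.sinh (R / 2) * Real.cosh (R / 2) := by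
      rw [← Real.sinh_two_mul]; congr 1; ring
    rw [this]; ring
  set S := Real.sinh R ^ 2 with hSdef
  set C := Real.cosh (R / 2)
  set h := Real.sinh (R / 2)
  have hhpos : 0 < h := by linarith
  have hSpos : 0 < S := by rw [hS]; positivity
  have key : t * cutoff S t ≤ 3 / 2 * C ^ 2 := by
    rcases le_total (1 - (t ^ 2 - 1) / S) 0 with hneg | hpos
    · rw [cutoff, max_eq_right hneg, mul_zero]; positivity
    · rw [cutoff, max_eq_left hpos]
      set s := t ^ 2 - 1 with hs
      have hs0 : 0 ≤ s := by nlinarith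
      have hsS : 0 ≤ s / S := by positivity
      refine abs_le_of_sq_le_sq' ?_ (by positivity) |>.2
      -- After squaring, one factor 1 - s/S ≤ 1 is dropped. The rest is a quadratic in s, bounded by
      -- 1 + S/4 = 1 + h²C², and C² = 1 + h².
      have h1 : (t * (1 - s / S)) ^ 2 ≤ (1 + s) * (1 - s / S) := by
        have : (t * (1 - s / S)) ^ 2 = (1 + s) * (1 - s / S) * (1 - s / S) := by
          rw [hs]; ring
        rw [this]
        exact mul_le_of_le_one_right (by positivity) (by linarith)
      have h2 : (1 + s) * (1 - s / S) ≤ 1 + S / 4 := by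
        have : s = s / S * S := by field_simp
        have h3 : s * (s / S) = (s / S) ^ 2 * S := by rw [sq]; nth_rw 1 [this]; ring
        nlinarith [mul_nonneg hSpos.le (sq_nonneg (s / S - 1 / 2))]
      have h3 : 1 + S / 4 ≤ (3 / 2 * C ^ 2) ^ 2 := by
        rw [hS, hsq]
        nlinarith [sq_nonneg h, sq_nonneg (h ^ 2)]
      linarith
  calc 2 / S * (t * cutoff S t) ≤ 2 / S * (3 / 2 * C ^ 2) := by gcongr
    _ = 3 / (4 * h ^ 2) := by
      have : C ≠ 0 := by positivity
      rw [hS]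
      field_simp
    _ ≤ 3 / R ^ 2 := by
      apply div_le_div_of_nonneg_left (by norm_num) (by positivity)
      nlinarith

theorem cutoff_le_one {S t : ℝ} (hS : 0 < S) (ht : 1 ≤ t) : cutoff S t ≤ 1 := by
  have : 0 ≤ (t ^ 2 - 1) / S := div_nonneg (by nlinarith) hS.le
  exact max_le (by linarith) zero_le_one

theorem cutoff_eq_zero {R t : ℝ} (hR : 0 < R) (ht : Real.cosh R ≤ t) :
    cutoff (Real.sinh R ^ 2) t = 0 := by
  have h1 : 0 < Real.sinh R ^ 2 := pow_pos (Real.sinh_pos_iff.2 hR) 2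
  have h2 := Real.cosh_sq R
  have h3 := Real.one_le_cosh R
  refine max_eq_right ?_
  rw [sub_nonpos, le_div_iff₀ h1]
  nlinarith

/-! ### The regularized monotonicity inequality -/

section Mono

variable {M : Type*} [TopologicalSpace M] [ChartedSpace Plane M] {F : M → Mink}

theorem IsHypImmersion.continuous_lorentz (hF : IsHypImmersion F) (q : Mink) :
    Continuous fun x => lorentz q (F x) :=
  _root_.continuous_lorentz.comp (continuous_const.prodMk hF.smooth.continuous)

theorem IsHypImmersion.continuous_hypDist (hF : IsHypImmersion F) (x₀ : M) :
    Continuous fun x => hypDist (F x₀) (F x) :=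
  Real.continuousOn_arcosh.comp_continuous (hF.continuous_lorentz (F x₀)).neg
    fun x => one_le_neg_lorentz (hF.mem x₀) (hF.mem x)

variable [IsManifold (𝓡 2) ∞ M] [CompactSpace M] [T2Space M] [MeasurableSpace M] [BorelSpace M]

/-- The regularized monotonicity inequality. -/
theorem IsHypImmersion.integral_regularized_le (hF : IsHypImmersion F) (x₀ : M) {R c : ℝ}
    (hR : 0 < R) (hc : 0 < c) :
    ∫ x, c * cutoff (Real.sinh R ^ 2) (-lorentz (F x₀) (F x)) ^ 2 /
        (lorentz (F x₀) (F x) ^ 2 - 1 + c) ^ 2 ∂(areaMeasure F) ≤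
      3 / R ^ 2 * (areaMeasure F).real {x | hypDist (F x₀) (F x) < R} +
        1 / 4 * ∫ x in {x | hypDist (F x₀) (F x) < R}, meanCurvature F x ^ 2 ∂(areaMeasure F) := by
  have hloc := hF.isLocallyFiniteMeasure
  set S := Real.sinh R ^ 2 with hSdef
  have hS : 0 < S := pow_pos (Real.sinh_pos_iff.2 hR) 2
  -- With this sign ⟨q, F x⟩ = cosh d(F x₀, F x) ≥ 1.
  set q := -F x₀ with hq
  have hqf : ∀ x, lorentz q (F x) = -lorentz (F x₀) (F x) := fun x => lorentz_neg_left _ _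
  have hf1 : ∀ x, 1 ≤ lorentz q (F x) := fun x => by
    rw [hqf]; exact one_le_neg_lorentz (hF.mem x₀) (hF.mem x)
  have hqq : lorentz q q = -1 := by
    rw [hq, lorentz_neg_left, lorentz_comm, lorentz_neg_left, (hF.mem x₀).1]; ring
  have hfc := hF.continuous_lorentz q
  have hyc : Continuous fun x => cutoff S (lorentz q (F x)) := (continuous_cutoff S).comp hfc
  have hHc := hF.continuous_meanCurvature_sq
  have hne : ∀ x, (lorentz q (F x) ^ 2 - 1 + c) ^ 2 ≠ 0 := fun x => by
    have := hf1 x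
    have : 0 < lorentz q (F x) ^ 2 - 1 + c := by nlinarith
    positivity
  have c1 : Continuous fun x => c * cutoff S (lorentz q (F x)) ^ 2 /
      (lorentz q (F x) ^ 2 - 1 + c) ^ 2 :=
    (continuous_const.mul (hyc.pow 2)).div
      ((((hfc.pow 2).sub continuous_const).add continuous_const).pow 2) hne
  have c2 : Continuous fun x => 2 / S * (lorentz q (F x) * cutoff S (lorentz q (F x))) :=
    continuous_const.mul (hfc.mul hyc)
  have c3 : Continuous fun x => 1 / 4 * (meanCurvature F x ^ 2 * cutoff S (lorentz q (F x)) ^ 2) :=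
    continuous_const.mul (hHc.mul (hyc.pow 2))
  have hopen : IsOpen {t : ℝ | 0 < t ^ 2 - 1 + c} :=
    isOpen_lt continuous_const (by fun_prop)
  have hmain := hF.integral_nonpos q hopen (contDiffOn_radialWeight S c)
    (fun x => by have := hf1 x; simp only [Set.mem_ofPred_eq]; nlinarith)
    (B := fun x => 2 * (c * cutoff S (lorentz q (F x)) ^ 2 / (lorentz q (F x) ^ 2 - 1 + c) ^ 2
      - 2 / S * (lorentz q (F x) * cutoff S (lorentz q (F x)))
      - 1 / 4 * (meanCurvature F x ^ 2 * cutoff S (lorentz q (F x)) ^ 2)))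
    (continuous_const.mul ((c1.sub c2).sub c3))
    (fun x H n hH => by
      rw [← hH, hqq]
      exact radialWeight_bound hS hc (hf1 x) H n)
  have i1 := hF.integrable_of_continuous c1
  have i2 := hF.integrable_of_continuous c2
  have i3 := hF.integrable_of_continuous c3
  have i12 : Integrable (fun x => c * cutoff S (lorentz q (F x)) ^ 2 /
      (lorentz q (F x) ^ 2 - 1 + c) ^ 2 - 2 / S * (lorentz q (F x) * cutoff S (lorentz q (F x))))
      (areaMeasure F) := i1.sub i2
  rw [integral_const_mul, integral_sub i12 i3, integral_sub i1 i2] at hmain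
  set Bl := {x | hypDist (F x₀) (F x) < R} with hBl
  have hBm : MeasurableSet Bl :=
    (isOpen_lt (hF.continuous_hypDist x₀) continuous_const).measurableSet
  have hzero : ∀ x ∉ Bl, cutoff S (lorentz q (F x)) = 0 := by
    intro x hx
    simp only [hBl, Set.mem_ofPred_eq, not_lt] at hx
    refine cutoff_eq_zero hR ?_
    rw [hqf, ← cosh_hypDist (hF.mem x₀) (hF.mem x), Real.cosh_le_cosh, abs_of_pos hR]
    exact hx.trans (le_abs_self _)
  have b2 : ∫ x, 2 / S * (lorentz q (F x) * cutoff S (lorentz q (F x))) ∂(areaMeasure F) ≤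
      3 / R ^ 2 * (areaMeasure F).real Bl := by
    rw [← setIntegral_eq_integral_of_forall_compl_eq_zero (s := Bl) fun x hx => by
      rw [hzero x hx]; ring]
    have : ∫ x in Bl, (3 / R ^ 2 : ℝ) ∂(areaMeasure F) = 3 / R ^ 2 * (areaMeasure F).real Bl := by
      rw [setIntegral_const, smul_eq_mul, mul_comm]
    rw [← this]
    refine setIntegral_mono i2.integrableOn (integrableOn_const (by
      exact (measure_lt_top_of_subset (Set.subset_univ _)
        isCompact_univ.measure_lt_top.ne).ne)) fun x => mul_cutoff_le hR (hf1 x)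
  have b3 : ∫ x, 1 / 4 * (meanCurvature F x ^ 2 * cutoff S (lorentz q (F x)) ^ 2) ∂(areaMeasure F) ≤
      1 / 4 * ∫ x in Bl, meanCurvature F x ^ 2 ∂(areaMeasure F) := by
    rw [← integral_const_mul, ← setIntegral_eq_integral_of_forall_compl_eq_zero (s := Bl)
      fun x hx => by rw [hzero x hx]; ring]
    refine setIntegral_mono i3.integrableOn
      ((hF.integrable_of_continuous hHc).const_mul _).integrableOn fun x => ?_
    have h1 := cutoff_le_one hS (hf1 x)
    have h0 := cutoff_nonneg S (lorentz q (F x))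
    have : cutoff S (lorentz q (F x)) ^ 2 ≤ 1 := pow_le_one₀ h0 h1
    have := mul_le_of_le_one_right (sq_nonneg (meanCurvature F x)) this
    simp only
    linarith
  have heq : ∀ x, lorentz q (F x) ^ 2 = lorentz (F x₀) (F x) ^ 2 := fun x => by rw [hqf, neg_sq]
  simp only [heq] at hmain
  simp only [hqf] at hmain b2 b3
  linarith

end Mono

/-! ### The density at a point -/

theorem integral_Ioi_mul_inv_one_add_sq_sq :
    ∫ y in Set.Ioi (0 : ℝ), y * (1 / (1 + y ^ 2) ^ 2) = 1 / 2 := by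
  have hd : ∀ y ∈ Set.Ici (0 : ℝ), HasDerivAt (fun y : ℝ => -(1 / 2) * (1 + y ^ 2)⁻¹)
      (y * (1 / (1 + y ^ 2) ^ 2)) y := by
    intro y _
    have h0 : (1 : ℝ) + y ^ 2 ≠ 0 := by positivity
    have h1 : HasDerivAt (fun y : ℝ => 1 + y ^ 2) (2 * y) y := by
      simpa using (hasDerivAt_pow 2 y).const_add 1
    refine ((h1.fun_inv h0).const_mul (-(1 / 2))).congr_deriv ?_
    field_simp
  have ht : Filter.Tendsto (fun y : ℝ => -(1 / 2) * (1 + y ^ 2)⁻¹) Filter.atTop (nhds 0) := by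
    have h1 : Filter.Tendsto (fun y : ℝ => 1 + y ^ 2) Filter.atTop Filter.atTop :=
      Filter.tendsto_atTop_add_const_left _ _ (Filter.tendsto_pow_atTop (by norm_num))
    simpa using (tendsto_inv_atTop_zero.comp h1).const_mul (-(1 / 2 : ℝ))
  have hint := integrableOn_Ioi_deriv_of_nonneg' hd
    (fun y hy => mul_nonneg (le_of_lt hy) (by positivity)) ht
  rw [integral_Ioi_of_hasDerivAt_of_tendsto' hd hint ht]
  norm_num

/-- Polar coordinates: 2 · π · (1/2). This is the constant π of the monotonicity inequality. -/
theorem integral_inv_one_add_norm_sq_sq :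
    ∫ v : Plane, 1 / (1 + ‖v‖ ^ 2) ^ 2 = Real.pi := by
  have h := integral_fun_norm_addHaar (volume : Measure Plane)
    (fun y : ℝ => 1 / (1 + y ^ 2) ^ 2)
  have hb : (volume : Measure Plane).real (Metric.ball 0 1) = Real.pi := by
    simp [Measure.real, Real.pi_nonneg]
  rw [h, hb]
  simp only [finrank_euclideanSpace, Fintype.card_fin, Nat.add_one_sub_one, pow_one, smul_eq_mul,
    integral_Ioi_mul_inv_one_add_sq_sq, nsmul_eq_mul]
  push_cast
  ring

theorem pi_le_lintegral_norm :
    ENNReal.ofReal Real.pi ≤ ∫⁻ v : Plane, ENNReal.ofReal (1 / (1 + ‖v‖ ^ 2) ^ 2) := by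
  have hc : Continuous fun v : Plane => 1 / (1 + ‖v‖ ^ 2) ^ 2 :=
    continuous_const.div (by fun_prop) fun v => by positivity
  rw [← integral_inv_one_add_norm_sq_sq, integral_eq_lintegral_of_nonneg_ae
    (Filter.Eventually.of_forall fun v => by positivity) hc.aestronglyMeasurable]
  exact ENNReal.ofReal_toReal_le

/-- The linear map of the plane with matrix `!![a, b; 0, d]`. -/
noncomputable def upperTriangular (a b d : ℝ) : Plane →ₗ[ℝ] Plane :=
  Matrix.toLin (EuclideanSpace.basisFun (Fin 2) ℝ).toBasis
    (EuclideanSpace.basisFun (Fin 2) ℝ).toBasis !![a, b; 0, d]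

theorem det_upperTriangular (a b d : ℝ) : LinearMap.det (upperTriangular a b d) = a * d := by
  rw [upperTriangular, LinearMap.det_toLin, Matrix.det_fin_two]
  simp

theorem norm_upperTriangular_sq (a b d : ℝ) (v : Plane) :
    ‖upperTriangular a b d v‖ ^ 2 = (a * v 0 + b * v 1) ^ 2 + (d * v 1) ^ 2 := by
  have h0 : upperTriangular a b d v 0 = a * v 0 + b * v 1 := by
    simp [upperTriangular, Matrix.toLin_apply, Matrix.mulVec, dotProduct, Fin.sum_univ_two]
  have h1 : upperTriangular a b d v 1 = d * v 1 := by
    simp [upperTriangular, Matrix.toLin_apply, Matrix.mulVec, dotProduct, Fin.sum_univ_two]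
  rw [EuclideanSpace.norm_sq_eq, Fin.sum_univ_two, h0, h1, Real.norm_eq_abs, Real.norm_eq_abs,
    sq_abs, sq_abs]

/-- `L` is the Cholesky factor of the quadratic form with matrix (E, H; H, G), so the form is |Lv|²
and det L = √(EG - H²); then change variables. Here `H` is the off-diagonal entry of the metric. -/
theorem pi_le_lintegral_quadratic {E G H : ℝ} (hE : 0 < E) (hD : 0 < E * G - H ^ 2) :
    ENNReal.ofReal Real.pi ≤ ∫⁻ v : Plane, ENNReal.ofReal (√(E * G - H ^ 2) *
      (1 / (1 + (E * v 0 ^ 2 + 2 * H * (v 0 * v 1) + G * v 1 ^ 2)) ^ 2)) := by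
  set D := E * G - H ^ 2 with hDdef
  set L := upperTriangular (√E) (H / √E) (√D / √E) with hL
  have hsE : 0 < √E := Real.sqrt_pos.2 hE
  have hsD : 0 < √D := Real.sqrt_pos.2 hD
  have hdet : LinearMap.det L = √D := by
    rw [hL, det_upperTriangular]; field_simp
  have hLv : ∀ v : Plane, ‖L v‖ ^ 2 = E * v 0 ^ 2 + 2 * H * (v 0 * v 1) + G * v 1 ^ 2 := by
    intro v
    rw [hL, norm_upperTriangular_sq]
    have h1 : √E ^ 2 = E := Real.sq_sqrt hE.le
    have h2 : √D ^ 2 = D := Real.sq_sqrt hD.le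
    have h3 : (√E * v 0 + H / √E * v 1) ^ 2 + (√D / √E * v 1) ^ 2 =
        √E ^ 2 * v 0 ^ 2 + 2 * H * (v 0 * v 1) + (H ^ 2 + √D ^ 2) / √E ^ 2 * v 1 ^ 2 := by
      field_simp
      ring
    rw [h3, h1, h2, hDdef]
    field_simp
    ring
  have hmap := Measure.map_linearMap_addHaar_eq_smul_addHaar (volume : Measure Plane)
    (f := L) (by rw [hdet]; exact hsD.ne')
  have hc : Continuous fun v : Plane => 1 / (1 + ‖v‖ ^ 2) ^ 2 :=
    continuous_const.div (by fun_prop) fun v => by positivity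
  have hm : Measurable fun v : Plane => ENNReal.ofReal (1 / (1 + ‖v‖ ^ 2) ^ 2) :=
    hc.measurable.ennreal_ofReal
  have h1 := lintegral_map (μ := (volume : Measure Plane)) hm
    (L.continuous_of_finiteDimensional.measurable)
  rw [hmap, lintegral_smul_measure, hdet, abs_of_pos (inv_pos.2 hsD)] at h1
  calc ENNReal.ofReal Real.pi ≤ ∫⁻ v : Plane, ENNReal.ofReal (1 / (1 + ‖v‖ ^ 2) ^ 2) :=
        pi_le_lintegral_norm
    _ = ENNReal.ofReal √D * ∫⁻ v : Plane, ENNReal.ofReal (1 / (1 + ‖L v‖ ^ 2) ^ 2) := by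
        rw [← h1, smul_eq_mul, ← mul_assoc, ← ENNReal.ofReal_mul hsD.le, mul_inv_cancel₀ hsD.ne',
          ENNReal.ofReal_one, one_mul]
    _ = _ := by
        rw [← lintegral_const_mul' _ _ ENNReal.ofReal_ne_top]
        simp only [← ENNReal.ofReal_mul hsD.le, hLv]

/-! ### Blow-up at a point -/

theorem lintegral_comp_add_smul (f : Plane → ENNReal) (hf : Measurable f) (u₀ : Plane) {ε : ℝ}
    (hε : 0 < ε) :
    ∫⁻ v, ENNReal.ofReal (ε ^ 2) * f (u₀ + ε • v) = ∫⁻ u, f u := by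
  have hm : Measurable fun w : Plane => f (u₀ + w) := hf.comp (measurable_const_add u₀)
  have h1 := lintegral_map (μ := (volume : Measure Plane)) hm (measurable_const_smul ε)
  rw [Measure.map_addHaar_smul volume hε.ne', lintegral_smul_measure,
    lintegral_add_left_eq_self, finrank_euclideanSpace, Fintype.card_fin,
    abs_of_pos (by positivity)] at h1
  rw [lintegral_const_mul' _ _ ENNReal.ofReal_ne_top, ← h1, smul_eq_mul, ← mul_assoc,
    ← ENNReal.ofReal_mul (by positivity), mul_inv_cancel₀ (by positivity), ENNReal.ofReal_one,
    one_mul]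

open Filter Topology in
theorem HypPatch.tendsto_lorentz_sq {φ : Plane → Mink} {U : Set Plane} (h : HypPatch φ U)
    {u₀ : Plane} (hu : u₀ ∈ U) (v : Plane) :
    Tendsto (fun ε : ℝ => (lorentz (φ u₀) (φ (u₀ + ε • v)) ^ 2 - 1) / ε ^ 2) (𝓝[>] 0)
      (𝓝 (lorentz (fderiv ℝ φ u₀ v) (fderiv ℝ φ u₀ v))) := by
  have hd : HasDerivAt (fun t : ℝ => φ (u₀ + t • v)) (fderiv ℝ φ u₀ v) 0 :=
    ((h.differentiableAt hu).hasFDerivAt.hasLineDerivAt v)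
  rw [hasDerivAt_iff_tendsto_slope_zero] at hd
  simp only [zero_add, zero_smul, add_zero] at hd
  have hδ := hd.mono_left (nhdsWithin_mono 0 fun x (hx : 0 < x) => hx.ne')
  have hQ : Tendsto (fun ε : ℝ => lorentz (ε⁻¹ • (φ (u₀ + ε • v) - φ u₀))
      (ε⁻¹ • (φ (u₀ + ε • v) - φ u₀))) (𝓝[>] 0)
      (𝓝 (lorentz (fderiv ℝ φ u₀ v) (fderiv ℝ φ u₀ v))) :=
    (continuous_lorentz.tendsto _).comp (hδ.prodMk_nhds hδ)
  have hε : Tendsto (fun ε : ℝ => ε ^ 2) (𝓝[>] 0) (𝓝 0) := by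
    have : Tendsto (fun ε : ℝ => ε ^ 2) (𝓝 0) (𝓝 (0 ^ 2)) := (continuous_pow 2).tendsto 0
    rw [zero_pow two_ne_zero] at this
    exact this.mono_left nhdsWithin_le_nhds
  -- For the chord δ between two points, ⟨δ, δ⟩ = 2(cosh r - 1), hence sinh² r = (⟨δ, δ⟩/2)(2 + ⟨δ,
  -- δ⟩/2); here δ is rescaled by ε.
  have hlim := (hQ.const_mul (1 / 2)).mul (((hε.mul hQ).const_mul (1 / 2)).const_add 2)
  have hval : 1 / 2 * lorentz (fderiv ℝ φ u₀ v) (fderiv ℝ φ u₀ v) *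
      (2 + 1 / 2 * (0 * lorentz (fderiv ℝ φ u₀ v) (fderiv ℝ φ u₀ v))) =
      lorentz (fderiv ℝ φ u₀ v) (fderiv ℝ φ u₀ v) := by ring
  rw [hval] at hlim
  refine hlim.congr' ?_
  have hU : ∀ᶠ ε : ℝ in 𝓝[>] 0, u₀ + ε • v ∈ U := by
    have hc : Tendsto (fun ε : ℝ => u₀ + ε • v) (𝓝 0) (𝓝 (u₀ + (0 : ℝ) • v)) :=
      (by fun_prop : Continuous fun ε : ℝ => u₀ + ε • v).tendsto 0
    rw [zero_smul, add_zero] at hc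
    exact (hc.mono_left nhdsWithin_le_nhds).eventually (h.isOpen.mem_nhds hu)
  filter_upwards [hU, self_mem_nhdsWithin] with ε hεU hεpos
  have hεne : ε ≠ 0 := ne_of_gt hεpos
  simp only [lorentz_smul_left, lorentz_smul_right, lorentz_sub_left, lorentz_sub_right,
    (h.mem _ hεU).1, (h.mem _ hu).1, lorentz_comm (φ (u₀ + ε • v)) (φ u₀)]
  field_simp
  ring

theorem HypPatch.metric_eq {φ : Plane → Mink} {u₀ : Plane} (v : Plane) :
    lorentz (fderiv ℝ φ u₀ v) (fderiv ℝ φ u₀ v) =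
      lorentz (pd φ 0 u₀) (pd φ 0 u₀) * v 0 ^ 2 +
      2 * lorentz (pd φ 0 u₀) (pd φ 1 u₀) * (v 0 * v 1) +
      lorentz (pd φ 1 u₀) (pd φ 1 u₀) * v 1 ^ 2 := by
  have : fderiv ℝ φ u₀ v = v 0 • pd φ 0 u₀ + v 1 • pd φ 1 u₀ := by
    conv_lhs => rw [plane_eq_sum v]
    rw [map_add, map_smul, map_smul]
    rfl
  rw [this]
  simp only [lorentz_add_left, lorentz_add_right, lorentz_smul_left, lorentz_smul_right,
    lorentz_comm (pd φ 1 u₀) (pd φ 0 u₀)]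
  ring

/-- The regularized integrand in coordinates. -/
noncomputable def densityIntegrand (φ : Plane → Mink) (p : Mink) (S ε : ℝ) (u : Plane) : ℝ :=
  √(firstForm φ u).det *
    (ε ^ 2 * cutoff S (-lorentz p (φ u)) ^ 2 / (lorentz p (φ u) ^ 2 - 1 + ε ^ 2) ^ 2)

open Filter Topology in
-- At scale ε, with regularization c = ε², the outer factor ε² is the Jacobian of the blow-up. The
-- cutoff tends to 1 and sinh² r / ε² tends to the metric evaluated on `v`.
theorem HypPatch.tendsto_densityIntegrand {φ : Plane → Mink} {U : Set Plane} (h : HypPatch φ U)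
    {u₀ : Plane} (hu : u₀ ∈ U) (S : ℝ) (v : Plane) :
    Tendsto (fun ε : ℝ => ε ^ 2 * densityIntegrand φ (φ u₀) S ε (u₀ + ε • v)) (𝓝[>] 0)
      (𝓝 (√(firstForm φ u₀).det *
        (1 / (1 + lorentz (fderiv ℝ φ u₀ v) (fderiv ℝ φ u₀ v)) ^ 2))) := by
  have hc : Tendsto (fun ε : ℝ => u₀ + ε • v) (𝓝[>] 0) (𝓝 u₀) := by
    have hc : Tendsto (fun ε : ℝ => u₀ + ε • v) (𝓝 0) (𝓝 (u₀ + (0 : ℝ) • v)) :=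
      (by fun_prop : Continuous fun ε : ℝ => u₀ + ε • v).tendsto 0
    rw [zero_smul, add_zero] at hc
    exact hc.mono_left nhdsWithin_le_nhds
  have hD : Tendsto (fun ε : ℝ => √(firstForm φ (u₀ + ε • v)).det) (𝓝[>] 0)
      (𝓝 √(firstForm φ u₀).det) :=
    (h.contDiffOn_sqrt_det.continuousOn.continuousAt (h.isOpen.mem_nhds hu)).tendsto.comp hc
  have hy : Tendsto (fun ε : ℝ => cutoff S (-lorentz (φ u₀) (φ (u₀ + ε • v)))) (𝓝[>] 0)
      (𝓝 1) := by
    have h1 : ContinuousAt (fun u => cutoff S (-lorentz (φ u₀) (φ u))) u₀ :=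
      (continuous_cutoff S).continuousAt.comp
        (continuous_lorentz.continuousAt.comp (continuousAt_const.prodMk
          (h.differentiableAt hu).continuousAt)).neg
    have h2 : cutoff S (-lorentz (φ u₀) (φ u₀)) = 1 := by
      rw [(h.mem _ hu).1]; simp [cutoff]
    have h3 := h1.tendsto.comp hc
    rw [h2] at h3
    exact h3
  have hg := h.lorentz_fderiv hu v
  have hg0 : 0 ≤ lorentz (fderiv ℝ φ u₀ v) (fderiv ℝ φ u₀ v) :=
    lorentz_self_nonneg (h.mem _ hu) hg
  have hlim := hD.mul ((hy.pow 2).div (((h.tendsto_lorentz_sq hu v).const_add 1).pow 2)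
    (by positivity))
  rw [one_pow] at hlim
  simp only [Pi.div_apply] at hlim
  refine hlim.congr' ?_
  have hU : ∀ᶠ ε : ℝ in 𝓝[>] 0, u₀ + ε • v ∈ U := hc.eventually (h.isOpen.mem_nhds hu)
  filter_upwards [hU, self_mem_nhdsWithin] with ε hεU hεpos
  have hεp : 0 < ε := hεpos
  have hs : 0 ≤ lorentz (φ u₀) (φ (u₀ + ε • v)) ^ 2 - 1 := by
    have := one_le_neg_lorentz (h.mem _ hu) (h.mem _ hεU)
    nlinarith
  rw [densityIntegrand]
  have h1 : lorentz (φ u₀) (φ (u₀ + ε • v)) ^ 2 - 1 + ε ^ 2 ≠ 0 := by positivity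
  have h2 : 1 + (lorentz (φ u₀) (φ (u₀ + ε • v)) ^ 2 - 1) / ε ^ 2 =
      (lorentz (φ u₀) (φ (u₀ + ε • v)) ^ 2 - 1 + ε ^ 2) / ε ^ 2 := by
    field_simp; ring
  rw [h2]
  field_simp

open Filter Topology in
/-- The area of a patch concentrates at a point with density at least `π`. -/
theorem HypPatch.pi_le_of_forall_lintegral_le {φ : Plane → Mink} {U : Set Plane}
    (h : HypPatch φ U) {u₀ : Plane} (hu : u₀ ∈ U) (S : ℝ) {K : ENNReal}
    (hK : ∀ ε > 0, ∫⁻ u in U, ENNReal.ofReal (densityIntegrand φ (φ u₀) S ε u) ≤ K) :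
    ENNReal.ofReal Real.pi ≤ K := by
  set Φ : ℝ → Plane → ENNReal := fun ε =>
    U.indicator fun u => ENNReal.ofReal (densityIntegrand φ (φ u₀) S ε u) with hΦ
  have hmeas : ∀ ε ≠ 0, Measurable (Φ ε) := by
    intro ε hε
    have hl : ContinuousOn (fun u => lorentz (φ u₀) (φ u)) U :=
      continuous_lorentz.comp_continuousOn (continuousOn_const.prodMk h.contDiffOn.continuousOn)
    have hc : ContinuousOn (densityIntegrand φ (φ u₀) S ε) U := by
      refine h.contDiffOn_sqrt_det.continuousOn.mul (ContinuousOn.div ?_ ?_ ?_)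
      · exact continuousOn_const.mul (((continuous_cutoff S).comp_continuousOn hl.neg).pow 2)
      · exact (((hl.pow 2).sub continuousOn_const).add continuousOn_const).pow 2
      · intro u huU
        have := one_le_neg_lorentz (h.mem _ hu) (h.mem _ huU)
        have : 0 ≤ lorentz (φ u₀) (φ u) ^ 2 - 1 := by nlinarith
        positivity
    have hc' := ENNReal.continuous_ofReal.comp_continuousOn hc
    classical
    have := hc'.measurable_piecewise (g := 0) continuousOn_const h.isOpen.measurableSet
    rw [Set.piecewise_eq_indicator] at this
    exact this
  have hE : 0 < lorentz (pd φ 0 u₀) (pd φ 0 u₀) := h.metric_pos hu (by simp)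
  have hDpos := h.det_pos hu
  have hpi := pi_le_lintegral_quadratic hE (by rwa [← firstForm_det])
  rw [← firstForm_det] at hpi
  refine hpi.trans ?_
  have hpt : ∀ v : Plane, ENNReal.ofReal (√(firstForm φ u₀).det *
      (1 / (1 + (lorentz (pd φ 0 u₀) (pd φ 0 u₀) * v 0 ^ 2 +
      2 * lorentz (pd φ 0 u₀) (pd φ 1 u₀) * (v 0 * v 1) +
      lorentz (pd φ 1 u₀) (pd φ 1 u₀) * v 1 ^ 2)) ^ 2)) =
      liminf (fun ε : ℝ => ENNReal.ofReal (ε ^ 2) * Φ ε (u₀ + ε • v)) (𝓝[>] 0) := by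
    intro v
    rw [← HypPatch.metric_eq]
    refine (Tendsto.liminf_eq ?_).symm
    refine (ENNReal.tendsto_ofReal (h.tendsto_densityIntegrand hu S v)).congr' ?_
    have hc : Tendsto (fun ε : ℝ => u₀ + ε • v) (𝓝[>] 0) (𝓝 u₀) := by
      have hc : Tendsto (fun ε : ℝ => u₀ + ε • v) (𝓝 0) (𝓝 (u₀ + (0 : ℝ) • v)) :=
        (by fun_prop : Continuous fun ε : ℝ => u₀ + ε • v).tendsto 0
      rw [zero_smul, add_zero] at hc
      exact hc.mono_left nhdsWithin_le_nhds
    filter_upwards [hc.eventually (h.isOpen.mem_nhds hu)] with ε hεU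
    simp only [hΦ]
    rw [Set.indicator_of_mem hεU, ENNReal.ofReal_mul (sq_nonneg ε)]
  simp only [hpt]
  -- Fatou's lemma suffices because only a lower bound on the density is needed. It asks for
  -- measurability at every ε; at ε = 0 the factor ε² makes the integrand zero.
  refine (lintegral_liminf_le' fun ε => ?_).trans ?_
  · rcases eq_or_ne ε 0 with rfl | hε
    · simp
    · exact (((hmeas ε hε).comp ((measurable_const_smul ε).const_add u₀)).const_mul _).aemeasurable
  · refine (liminf_le_liminf (v := fun _ => K) ?_).trans_eq (liminf_const K)
    filter_upwards [self_mem_nhdsWithin] with ε hε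
    have hεp : 0 < ε := hε
    rw [lintegral_comp_add_smul _ (hmeas ε hεp.ne') u₀ hεp]
    simp only [hΦ]
    rw [lintegral_indicator h.isOpen.measurableSet]
    exact hK ε hεp

section Density

variable {M : Type*} [TopologicalSpace M] [ChartedSpace Plane M] [IsManifold (𝓡 2) ∞ M]
  [CompactSpace M] [T2Space M] [MeasurableSpace M] [BorelSpace M] {F : M → Mink}

/-- The monotonicity inequality: a ball of radius `R` centred on the surface contains a definite
amount of area or of Willmore energy. -/
theorem IsHypImmersion.pi_le (hF : IsHypImmersion F) (x₀ : M) {R : ℝ} (hR : 0 < R) :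
    Real.pi ≤ 3 / R ^ 2 * (areaMeasure F).real {x | hypDist (F x₀) (F x) < R} +
      1 / 4 * ∫ x in {x | hypDist (F x₀) (F x) < R}, meanCurvature F x ^ 2 ∂(areaMeasure F) := by
  set K := 3 / R ^ 2 * (areaMeasure F).real {x | hypDist (F x₀) (F x) < R} +
      1 / 4 * ∫ x in {x | hypDist (F x₀) (F x) < R}, meanCurvature F x ^ 2 ∂(areaMeasure F) with hK
  have hK0 : 0 ≤ K :=
    add_nonneg (by positivity) (mul_nonneg (by norm_num) (integral_nonneg fun x => sq_nonneg _))
  have he := chart_mem_atlas Plane x₀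
  have hx := mem_chart_source Plane x₀
  have hP := hF.hypPatch he
  have hφ : (F ∘ (chartAt Plane x₀).symm) (chartAt Plane x₀ x₀) = F x₀ := by
    simp [(chartAt Plane x₀).left_inv hx]
  rw [← ENNReal.ofReal_le_ofReal_iff hK0]
  refine hP.pi_le_of_forall_lintegral_le ((chartAt Plane x₀).map_source hx) (Real.sinh R ^ 2)
    fun ε hε => ?_
  rw [hφ]
  set f : M → ℝ := fun x => ε ^ 2 * cutoff (Real.sinh R ^ 2) (-lorentz (F x₀) (F x)) ^ 2 /
        (lorentz (F x₀) (F x) ^ 2 - 1 + ε ^ 2) ^ 2 with hf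
  have hlc := hF.continuous_lorentz (F x₀)
  have hfc : Continuous f := by
    refine Continuous.div ?_ ?_ ?_
    · exact continuous_const.mul (((continuous_cutoff _).comp hlc.neg).pow 2)
    · exact (((hlc.pow 2).sub continuous_const).add continuous_const).pow 2
    · intro x
      have := one_le_neg_lorentz (hF.mem x₀) (hF.mem x)
      have : 0 ≤ lorentz (F x₀) (F x) ^ 2 - 1 := by nlinarith
      positivity
  have hf0 : ∀ x, 0 ≤ f x := fun x => by positivity
  have h1 := hF.lintegral_chart_le he (f := fun x => ENNReal.ofReal (f x))
    hfc.measurable.ennreal_ofReal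
  rw [← ofReal_integral_eq_lintegral_ofReal (hF.integrable_of_continuous hfc)
    (Filter.Eventually.of_forall hf0)] at h1
  refine le_trans (le_of_eq ?_) (h1.trans (ENNReal.ofReal_le_ofReal
    (hF.integral_regularized_le x₀ hR (by positivity))))
  refine lintegral_congr fun u => ?_
  rw [densityIntegrand, ENNReal.ofReal_mul (Real.sqrt_nonneg _)]
  rfl

end Density

/-! ### The diameter bound -/

section Diameter

variable {M : Type*} [TopologicalSpace M] [CompactSpace M] [ConnectedSpace M]
  [ChartedSpace Plane M] {F : M → Mink}

theorem IsHypImmersion.isGreatest_extrinsicDiam (hF : IsHypImmersion F) :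
    IsGreatest (extrinsicDistances F) (extrinsicDiam F) := by
  have hc : Continuous fun p : M × M => hypDist (F p.1) (F p.2) :=
    Real.continuousOn_arcosh.comp_continuous
      (_root_.continuous_lorentz.comp ((hF.smooth.continuous.comp continuous_fst).prodMk
        (hF.smooth.continuous.comp continuous_snd))).neg
      fun p => one_le_neg_lorentz (hF.mem p.1) (hF.mem p.2)
  exact (isCompact_range hc).isGreatest_sSup (Set.range_nonempty _)

variable [IsManifold (𝓡 2) ∞ M] [T2Space M] [MeasurableSpace M] [BorelSpace M]

/-- Adding up the monotonicity inequality over disjoint balls centred along the surface. -/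
theorem IsHypImmersion.extrinsicDiam_mul_le (hF : IsHypImmersion F) {R : ℝ} (hR : 0 < R) :
    extrinsicDiam F / (2 * R) * Real.pi ≤
      3 / R ^ 2 * surfaceArea F + 1 / 4 * willmoreEnergy F := by
  have hloc := hF.isLocallyFiniteMeasure
  have hfin : IsFiniteMeasure (areaMeasure F) := ⟨isCompact_univ.measure_lt_top⟩
  obtain ⟨⟨⟨p, q⟩, hpq⟩, -⟩ := hF.isGreatest_extrinsicDiam
  simp only at hpq
  set D := extrinsicDiam F with hD
  have hD0 : 0 ≤ D := by rw [← hpq]; exact hypDist_nonneg (hF.mem p) (hF.mem q)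
  set n := ⌊D / (2 * R)⌋₊ with hn
  -- The distance from `p` takes every value in [0, D] by connectedness, and 2Ri ≤ D for i ≤ n. The
  -- indices 0, ..., n give n + 1 ≥ D/(2R) centres; beyond them `x` is the junk value `p`.
  have hx : ∀ i : ℕ, ∃ x : M, i ∈ Finset.range (n + 1) → hypDist (F p) (F x) = 2 * R * i := by
    intro i
    by_cases hi : i ∈ Finset.range (n + 1)
    · have hi' : (i : ℝ) ≤ D / (2 * R) :=
        (Nat.cast_le.2 (Nat.lt_succ_iff.1 (Finset.mem_range.1 hi))).trans
          (Nat.floor_le (by positivity))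
      rw [le_div_iff₀ (by positivity)] at hi'
      obtain ⟨x, hx⟩ := intermediate_value_univ p q (hF.continuous_hypDist p)
        (show 2 * R * i ∈ Set.Icc _ _ from
          ⟨by rw [hypDist_self (hF.mem p)]; positivity, by rw [hpq]; linarith⟩)
      exact ⟨x, fun _ => hx⟩
    · exact ⟨p, fun h => absurd h hi⟩
  choose x hx using hx
  set B : ℕ → Set M := fun i => {y | hypDist (F (x i)) (F y) < R} with hB
  have hBm : ∀ i ∈ Finset.range (n + 1), MeasurableSet (B i) := fun i _ =>
    (isOpen_lt (hF.continuous_hypDist (x i)) continuous_const).measurableSet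
  have hdisj' : ∀ i ∈ Finset.range (n + 1), ∀ j ∈ Finset.range (n + 1), i < j →
      Disjoint (B i) (B j) := by
    intro i hi j hj hij
    rw [Set.disjoint_left]
    intro y hyi hyj
    have h1 := hypDist_triangle (hF.mem p) (hF.mem (x i)) (hF.mem (x j))
    have h2 := hypDist_triangle (hF.mem (x i)) (hF.mem y) (hF.mem (x j))
    rw [hx i hi, hx j hj] at h1
    rw [hypDist_comm (F y)] at h2
    have h3 : hypDist (F (x i)) (F y) < R := hyi
    have h4 : hypDist (F (x j)) (F y) < R := hyj
    have h5 : (i : ℝ) + 1 ≤ j := by exact_mod_cast hij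
    nlinarith
  have hdisj : Set.PairwiseDisjoint (↑(Finset.range (n + 1))) B := by
    intro i hi j hj hij
    rcases lt_or_gt_of_ne hij with h | h
    · exact hdisj' i hi j hj h
    · exact (hdisj' j hj i hi h).symm
  have hH := hF.integrable_of_continuous hF.continuous_meanCurvature_sq
  have hsum : ∑ _i ∈ Finset.range (n + 1), Real.pi ≤ ∑ i ∈ Finset.range (n + 1),
      (3 / R ^ 2 * (areaMeasure F).real (B i) +
        1 / 4 * ∫ x in B i, meanCurvature F x ^ 2 ∂(areaMeasure F)) :=
    Finset.sum_le_sum fun i _ => hF.pi_le (x i) hR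
  rw [Finset.sum_const, Finset.card_range, Finset.sum_add_distrib, ← Finset.mul_sum,
    ← Finset.mul_sum, ← measureReal_biUnion_finset hdisj hBm,
    ← integral_biUnion_finset _ hBm hdisj fun i _ => hH.integrableOn, nsmul_eq_mul] at hsum
  have hA : (areaMeasure F).real (⋃ i ∈ Finset.range (n + 1), B i) ≤ surfaceArea F :=
    measureReal_mono (Set.subset_univ _)
  have hW : ∫ x in ⋃ i ∈ Finset.range (n + 1), B i, meanCurvature F x ^ 2 ∂(areaMeasure F) ≤
      willmoreEnergy F :=
    setIntegral_le_integral hH (Filter.Eventually.of_forall fun x => sq_nonneg _)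
  have hle : D / (2 * R) ≤ ((n + 1 : ℕ) : ℝ) := by
    push_cast
    exact (Nat.lt_floor_add_one _).le
  calc D / (2 * R) * Real.pi ≤ ((n + 1 : ℕ) : ℝ) * Real.pi := by gcongr
    _ ≤ _ := hsum
    _ ≤ _ := by gcongr

end Diameter

/-- After multiplying by 4R², this optimizes 2πDR ≤ 12A + WR² at R = πD/W. -/
theorem sq_le_of_forall_linear_le {D A W : ℝ} (hD : 0 ≤ D) (hA : 0 ≤ A) (hW : 0 ≤ W)
    (h : ∀ R > 0, D / (2 * R) * Real.pi ≤ 3 / R ^ 2 * A + 1 / 4 * W) :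
    Real.pi ^ 2 * D ^ 2 ≤ 12 * (A * W) := by
  have h' : ∀ R > 0, 2 * Real.pi * D * R ≤ 12 * A + W * R ^ 2 := by
    intro R hR
    have h1 := mul_le_mul_of_nonneg_left (h R hR) (by positivity : 0 ≤ 4 * R ^ 2)
    have e1 : 4 * R ^ 2 * (D / (2 * R) * Real.pi) = 2 * Real.pi * D * R := by field_simp; ring
    have e2 : 4 * R ^ 2 * (3 / R ^ 2 * A + 1 / 4 * W) = 12 * A + W * R ^ 2 := by field_simp; ring
    rwa [e1, e2] at h1
  have hpi := Real.pi_pos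
  rcases hD.eq_or_lt with rfl | hDpos
  · simpa using mul_nonneg hA hW
  · rcases hW.eq_or_lt with rfl | hWpos
    -- If W = 0 the left side is unbounded in R when D > 0; the chosen R makes it 12A + 1.
    · exfalso
      have h1 := h' ((12 * A + 1) / (2 * Real.pi * D)) (by positivity)
      rw [mul_div_cancel₀ _ (by positivity)] at h1
      linarith
    · have h1 := h' (Real.pi * D / W) (by positivity)
      have h2 := mul_le_mul_of_nonneg_right h1 hWpos.le
      have e1 : 2 * Real.pi * D * (Real.pi * D / W) * W = 2 * (Real.pi ^ 2 * D ^ 2) := by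
        field_simp
      have e2 : (12 * A + W * (Real.pi * D / W) ^ 2) * W =
          12 * (A * W) + Real.pi ^ 2 * D ^ 2 := by field_simp
      rw [e1, e2] at h2
      linarith

/-- Every closed connected surface smoothly immersed in `ℍ³` satisfies
`diam M ≤ 7 / (2π) * A(M)^{1/2} * W(M)^{1/2}`. The first three conjuncts say that the diameter is
an attained maximum, that the area is finite and that `H²` is integrable. -/
theorem lemma6p3 {M : Type*} [TopologicalSpace M] [T2Space M] [CompactSpace M] [ConnectedSpace M]
    [ChartedSpace Plane M] [IsManifold (𝓡 2) ∞ M] [MeasurableSpace M] [BorelSpace M]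
    (F : M → Mink) (hF : IsHypImmersion F) :
    IsGreatest (extrinsicDistances F) (extrinsicDiam F) ∧
    areaMeasure F Set.univ ≠ ⊤ ∧
    Integrable (fun x => meanCurvature F x ^ 2) (areaMeasure F) ∧
    extrinsicDiam F ≤
      7 / (2 * Real.pi) * surfaceArea F ^ (1 / 2 : ℝ) * willmoreEnergy F ^ (1 / 2 : ℝ) := by
  have hloc := hF.isLocallyFiniteMeasure
  have hgr := hF.isGreatest_extrinsicDiam
  refine ⟨hgr, isCompact_univ.measure_lt_top.ne,
    hF.integrable_of_continuous hF.continuous_meanCurvature_sq, ?_⟩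
  have hD0 : 0 ≤ extrinsicDiam F := by
    obtain ⟨⟨⟨p, q⟩, hpq⟩, -⟩ := hgr
    rw [← hpq]; exact hypDist_nonneg (hF.mem p) (hF.mem q)
  have hA0 : 0 ≤ surfaceArea F := measureReal_nonneg
  have hW0 : 0 ≤ willmoreEnergy F := integral_nonneg fun x => sq_nonneg _
  have hsq := sq_le_of_forall_linear_le hD0 hA0 hW0 fun R hR => hF.extrinsicDiam_mul_le hR
  rw [← Real.sqrt_eq_rpow, ← Real.sqrt_eq_rpow, mul_assoc, ← Real.sqrt_mul hA0]
  have hpi := Real.pi_pos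
  have hAW : 0 ≤ surfaceArea F * willmoreEnergy F := mul_nonneg hA0 hW0
  -- Compare squares: π²D² ≤ 12AW and 12 ≤ 49/4.
  refine abs_le_of_sq_le_sq' ?_ (by positivity) |>.2
  rw [mul_pow, div_pow, Real.sq_sqrt hAW, div_mul_eq_mul_div, le_div_iff₀ (by positivity)]
  nlinarith
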